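/- Fix a non-empty finite set $\mathbf A$ of agents, a countable set $\mathbf X$ of variables and a countable set $\mathbf P$ of unary predicate letters, each given with an effective numbering. Formulas of $\mathcal L^{[:=]}$ and their free variables $FV$ are defined simultaneously by $$\phi ::= p_x \mid \top \mid \neg\phi \mid (\phi\wedge\phi) \mid [x:=a]\phi \mid \mathsf K_S\alpha ,$$ where $p\in\mathbf P$, $x\in\mathbf X$, $a\in\mathbf A$, $S\subseteq\mathbf X$ is finite (possibly empty), and $\alpha$ is a formula with $FV(\alpha)=\emptyset$; here $FV(p_x)=\{x\}$, $FV(\top)=\emptyset$, $FV(\neg\phi)=FV(\phi)$, $FV(\phi\wedge\psi)=FV(\phi)\cup FV(\psi)$, $FV([x:=a]\phi)=FV(\phi)\setminus\{x\}$, $FV(\mathsf K_S\alpha)=S$. A sentence is a formula without free variables. Formulas are coded by natural numbers through a standard effective Gödel numbering. A simplicial model $\mathcal C=(\mathcal V,C,\chi,\ell)$ consists of a non-empty set $\mathcal V$ of vertices, a set $C\subseteq\wp(\mathcal V)$ of faces such that $\emptyset\notin C$, every non-empty subset of a face is a face, and every singleton is a face, a colouring $\chi:\mathcal V\to\mathbf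 A$ that is injective on each face, and a labelling $\ell:\mathbf P\to\wp(\mathcal V)$. Its facets are the inclusion-maximal faces. For a facet $F$ and an assignment $\sigma:\mathbf X\to\mathbf A$ with $\sigma[FV(\phi)]\subseteq\chi[F]$, the truth of $\phi$ at $F,\sigma$ is defined by the usual Boolean clauses and: * $F,\sigma\Vdash p_x$ iff $\sigma(x)\in\chi[F\cap\ell(p)]$; * $F,\sigma\Vdash[x:=a]\phi$ iff $a\in\chi[F]$ implies $F,\sigma[x\mapsto a]\Vdash\phi$; * $F,\sigma\Vdash\mathsf K_S\alpha$ iff $G,\sigma\Vdash\alpha$ for every facet $G$ with $\sigma[S]\subseteq\chi[F\cap G]$. A first-order Kripke model $(W,\delta,\{R_a\}_{a\in\mathbf A},\rho)$ consists of a non-empty set $W$, non-empty domains $\delta(w)\subseteq\mathbf A$, relations $R_a\subseteq W\times W$ with $R_a(w)=\emptyset$ whenever $a\notin\delta(w)$, and sets $\rho(p,w)\subseteq\delta(w)$. For $w\in W$ and $\sigma$ with $\sigma[FV(\phi)]\subseteq\delta(w)$, truth is defined by the usual Boolean clauses and: * $w,\sigma\vDash p_x$ iff $\sigma(x)\in\rho(p,w)$;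 * $w,\sigma\vDash[x:=a]\phi$ iff $a\in\delta(w)$ implies $w,\sigma[x\mapsto a]\vDash\phi$; * $w,\sigma\vDash\mathsf K_S\alpha$ iff $v,\sigma\vDash\alpha$ for every $v\in W$ such that $wR_av$ for all $a\in\sigma[S]$. The model is local epistemic if, for all $a\in\mathbf A$, $p\in\mathbf P$ and $w,v\in W$: $R_a$ restricted to $\{u\in W: a\in\delta(u)\}$ is an equivalence relation; if $a\in\delta(w)$ and $wR_av$ then $a\in\delta(v)$; if $a\in\rho(p,w)$ and $wR_av$ then $a\in\rho(p,v)$; and if $wR_bv$ for all $b\in\delta(w)$, then $\delta(v)\subseteq\delta(w)$. **Theorem.** The satisfiability problem for $\mathcal L^{[:=]}$-sentences is decidable, under both semantics: the set of codes of $\mathcal L^{[:=]}$-sentences that are true at some facet of some simplicial model is computable, and so is the set of codes of $\mathcal L^{[:=]}$-sentences that are true at some world of some local epistemic model. -/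

import Mathlib

universe uA uP uX w

namespace AssignLogic

/-- Raw syntax over agents `A`, predicate letters `P` and variables `X`:
`p_x`, `⊤`, `¬φ`, `φ ∧ ψ`, `[x := a] φ` and `K_S φ` with `S` a finite set of variables.
The side condition on `K_S φ` (no free variable in `φ`) is imposed by `IsFormula`. -/
inductive Form (A : Type uA) (P : Type uP) (X : Type uX) : Type (max uA uP uX)
  | atom (p : P) (x : X) : Form A P X
  | top : Form A P X
  | neg (φ : Form A P X) : Form A P X
  | and (φ ψ : Form A P X) : Form A P X
  | assign (x : X) (a : A) (φ : Form A P X) : Form A P X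
  | know (S : Finset X) (φ : Form A P X) : Form A P X

namespace Form

/-- The set of free variables. -/
def FV {A : Type uA} {P : Type uP} {X : Type uX} : Form A P X → Set X
  | atom _ x => {x}
  | top => ∅
  | neg φ => FV φ
  | and φ ψ => FV φ ∪ FV ψ
  | assign x _ φ => FV φ \ {x}
  | know S _ => (S : Set X)

/-- The raw expressions that are formulas of the language:
`K_S α` may be formed only when `α` has no free variable. -/
def IsFormula {A : Type uA} {P : Type uP} {X : Type uX} : Form A P X → Prop
  | atom _ _ => True
  | top => True
  | neg φ => IsFormula φ
  | and φ ψ => IsFormula φ ∧ IsFormula ψ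
  | assign _ _ φ => IsFormula φ
  | know _ α => IsFormula α ∧ FV α = ∅

/-- A sentence is a formula without free variables. -/
def IsSentence {A : Type uA} {P : Type uP} {X : Type uX} (φ : Form A P X) : Prop :=
  IsFormula φ ∧ FV φ = ∅

/-- Gödel numbering of the syntax. A finite set `S` of variables is coded by the number whose
binary digits equal to one are at the positions `encode x`, `x ∈ S`. -/
def code {A : Type uA} {P : Type uP} {X : Type uX} [Encodable A] [Encodable P] [Encodable X] :
    Form A P X → ℕ
  | atom p x => Nat.pair 0 (Nat.pair (Encodable.encode p) (Encodable.encode x))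
  | top => Nat.pair 1 0
  | neg φ => Nat.pair 2 (code φ)
  | and φ ψ => Nat.pair 3 (Nat.pair (code φ) (code ψ))
  | assign x a φ =>
      Nat.pair 4 (Nat.pair (Nat.pair (Encodable.encode x) (Encodable.encode a)) (code φ))
  | know S φ => Nat.pair 5 (Nat.pair (∑ x ∈ S, 2 ^ Encodable.encode x) (code φ))

theorem sum_two_pow_encode_injective {X : Type uX} [Encodable X] :
    Function.Injective (fun S : Finset X => ∑ x ∈ S, 2 ^ Encodable.encode x) := by
  intro S T h
  have key : ∀ U : Finset X, ∑ x ∈ U, 2 ^ Encodable.encode x =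
      ∑ i ∈ U.map ⟨Encodable.encode, Encodable.encode_injective⟩, 2 ^ i := by
    intro U
    rw [Finset.sum_map]
    rfl
  have h' : ∑ x ∈ S, 2 ^ Encodable.encode x = ∑ x ∈ T, 2 ^ Encodable.encode x := h
  rw [key S, key T] at h'
  exact Finset.map_injective _ (Finset.geomSum_injective (n := 2) le_rfl h')

/-- Distinct expressions have distinct codes. -/
theorem code_injective {A : Type uA} {P : Type uP} {X : Type uX}
    [Encodable A] [Encodable P] [Encodable X] :
    Function.Injective (code : Form A P X → ℕ) := by
  intro φ
  induction φ with
  | atom p x => intro ψ h; cases ψ <;> simp_all [code, Nat.pair_eq_pair]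
  | top => intro ψ h; cases ψ <;> simp_all [code, Nat.pair_eq_pair]
  | neg φ ih =>
    intro ψ h
    cases ψ <;> simp only [code, Nat.pair_eq_pair] at h <;> try omega
    rw [ih h.2]
  | and φ χ ih₁ ih₂ =>
    intro ψ h
    cases ψ <;> simp only [code, Nat.pair_eq_pair] at h <;> try omega
    rw [ih₁ h.2.1, ih₂ h.2.2]
  | assign x a φ ih =>
    intro ψ h
    cases ψ <;> simp only [code, Nat.pair_eq_pair] at h <;> try omega
    rw [ih h.2.2, Encodable.encode_injective h.2.1.1, Encodable.encode_injective h.2.1.2]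
  | know S φ ih =>
    intro ψ h
    cases ψ <;> simp only [code, Nat.pair_eq_pair] at h <;> try omega
    rw [ih h.2.2, sum_two_pow_encode_injective h.2.1]

end Form

/-- Simplicial models (possibly impure). -/
structure SimplicialModel (A : Type uA) (P : Type uP) : Type (max uA uP (w + 1)) where
  /-- vertices -/
  V : Type w
  nonempty : Nonempty V
  /-- faces -/
  faces : Set (Set V)
  empty_notMem : ∅ ∉ faces
  down_closed : ∀ F ∈ faces, ∀ Y : Set V, Y.Nonempty → Y ⊆ F → Y ∈ faces
  singleton_mem : ∀ v : V, {v} ∈ faces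
  /-- colouring -/
  color : V → A
  color_injOn : ∀ F ∈ faces, Set.InjOn color F
  /-- labelling -/
  label : P → Set V

namespace SimplicialModel

/-- The facets: faces that are not included in any other face. -/
def facets {A : Type uA} {P : Type uP} (C : SimplicialModel.{uA, uP, w} A P) : Set (Set C.V) :=
  {F | F ∈ C.faces ∧ ∀ Y ∈ C.faces \ {F}, ¬ F ⊆ Y}

/-- Simplicial semantics. The clauses are meant for assignments that are admissible
(`σ '' FV φ ⊆ color '' F`); on formulas, admissibility is inherited by every recursive call,
and every assignment is admissible for a sentence. -/
def Sat {A : Type uA} {P : Type uP} {X : Type uX} [DecidableEq X]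
    (C : SimplicialModel.{uA, uP, w} A P) : Set C.V → (X → A) → Form A P X → Prop
  | F, σ, .atom p x => σ x ∈ C.color '' (F ∩ C.label p)
  | _, _, .top => True
  | F, σ, .neg φ => ¬ C.Sat F σ φ
  | F, σ, .and φ ψ => C.Sat F σ φ ∧ C.Sat F σ ψ
  | F, σ, .assign x a φ => a ∈ C.color '' F → C.Sat F (Function.update σ x a) φ
  | F, σ, .know S α =>
      ∀ G ∈ C.facets, σ '' (S : Set X) ⊆ C.color '' (F ∩ G) → C.Sat G σ α

end SimplicialModel

/-- First-order Kripke models with varying non-empty local domains of agents. -/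
structure KripkeModel (A : Type uA) (P : Type uP) : Type (max uA uP (w + 1)) where
  /-- worlds -/
  W : Type w
  nonempty : Nonempty W
  /-- local domains -/
  dom : W → Set A
  dom_nonempty : ∀ u, (dom u).Nonempty
  /-- accessibility relations -/
  R : A → W → W → Prop
  R_empty : ∀ a u, a ∉ dom u → ∀ v, ¬ R a u v
  /-- interpretation of the predicate letters -/
  interp : P → W → Set A
  interp_subset : ∀ p u, interp p u ⊆ dom u

namespace KripkeModel

/-- First-order Kripke semantics (for admissible assignments, `σ '' FV φ ⊆ dom u`);
`K_∅` is the universal modality. -/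
def Sat {A : Type uA} {P : Type uP} {X : Type uX} [DecidableEq X]
    (M : KripkeModel.{uA, uP, w} A P) : M.W → (X → A) → Form A P X → Prop
  | u, σ, .atom p x => σ x ∈ M.interp p u
  | _, _, .top => True
  | u, σ, .neg φ => ¬ M.Sat u σ φ
  | u, σ, .and φ ψ => M.Sat u σ φ ∧ M.Sat u σ ψ
  | u, σ, .assign x a φ => a ∈ M.dom u → M.Sat u (Function.update σ x a) φ
  | u, σ, .know S α => ∀ v : M.W, (∀ a ∈ σ '' (S : Set X), M.R a u v) → M.Sat v σ α

/-- Local epistemic models. -/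
structure IsLocalEpistemic {A : Type uA} {P : Type uP}
    (M : KripkeModel.{uA, uP, w} A P) : Prop where
  local_S5 : ∀ a, Equivalence (fun u v : {u : M.W // a ∈ M.dom u} => M.R a u v)
  individually_increasing : ∀ u v, ∀ a ∈ M.dom u, M.R a u v → a ∈ M.dom v
  local_predicates : ∀ p u v, ∀ a ∈ M.interp p u, M.R a u v → a ∈ M.interp p v
  collectively_decreasing : ∀ u v, (∀ a ∈ M.dom u, M.R a u v) → M.dom v ⊆ M.dom u

end KripkeModel

namespace Form

/-- Satisfiability at a facet of some simplicial model. -/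
def SimplicialSatisfiable {A : Type uA} {P : Type uP} {X : Type uX} [DecidableEq X]
    (α : Form A P X) : Prop :=
  ∃ C : SimplicialModel.{uA, uP, w} A P, ∃ F ∈ C.facets, ∃ σ : X → A, C.Sat F σ α

/-- Satisfiability at a world of some local epistemic model. -/
def LocalEpistemicSatisfiable {A : Type uA} {P : Type uP} {X : Type uX} [DecidableEq X]
    (α : Form A P X) : Prop :=
  ∃ M : KripkeModel.{uA, uP, w} A P, M.IsLocalEpistemic ∧
    ∃ u : M.W, ∃ σ : X → A, M.Sat u σ α

end Form

end AssignLogic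

namespace AssignLogic

/-! ### Quasi-models -/

/-- Quasi-models: the relations for sets of agents are primitive, and need not be intersections
of relations for single agents. -/
structure QuasiModel (A : Type uA) (P : Type uP) : Type (max uA uP (w + 1)) where
  /-- worlds -/
  W : Type w
  /-- local domains -/
  dom : W → Set A
  dom_nonempty : ∀ u, (dom u).Nonempty
  /-- accessibility relations for sets of agents -/
  R : Set A → W → W → Prop
  /-- interpretation of the predicate letters -/
  interp : P → W → Set A
  interp_subset : ∀ p u, interp p u ⊆ dom u
  subset_dom : ∀ {B u v}, R B u v → B ⊆ dom u
  refl : ∀ {B u}, B ⊆ dom u → R B u u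
  symm : ∀ {B u v}, R B u v → R B v u
  trans : ∀ {B u v z}, R B u v → R B v z → R B u z
  mono : ∀ {B C u v}, B ⊆ C → R C u v → R B u v
  local_predicates : ∀ {B u v p a}, R B u v → a ∈ B → a ∈ interp p u → a ∈ interp p v
  -- Together with `subset_dom` the premise forces `B = dom u`, so this is the collective decrease
  -- of domains.
  decreasing : ∀ {B u v}, R B u v → dom u ⊆ B → dom v ⊆ B

namespace QuasiModel

variable {A : Type uA} {P : Type uP} {X : Type uX} [DecidableEq X]

/-- Semantics in quasi-models. -/
def Sat (M : QuasiModel.{uA, uP, w} A P) : M.W → (X → A) → Form A P X → Prop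
  | u, σ, .atom p x => σ x ∈ M.interp p u
  | _, _, .top => True
  | u, σ, .neg φ => ¬ M.Sat u σ φ
  | u, σ, .and φ ψ => M.Sat u σ φ ∧ M.Sat u σ ψ
  | u, σ, .assign x a φ => a ∈ M.dom u → M.Sat u (Function.update σ x a) φ
  | u, σ, .know S α => ∀ v : M.W, M.R (σ '' (S : Set X)) u v → M.Sat v σ α

theorem sat_congr (M : QuasiModel.{uA, uP, w} A P) (φ : Form A P X) (hφ : φ.IsFormula) :
    ∀ (u : M.W) (σ τ : X → A), (∀ x ∈ φ.FV, σ x = τ x) → (M.Sat u σ φ ↔ M.Sat u τ φ) := by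
  induction φ with
  | atom p x => intro u σ τ h; simp [Sat, h x (by simp [Form.FV])]
  | top => intro u σ τ h; simp [Sat]
  | neg φ ih => intro u σ τ h; simp only [Sat, ih hφ u σ τ h]
  | and φ ψ ih₁ ih₂ =>
    intro u σ τ h
    simp only [Sat, ih₁ hφ.1 u σ τ fun x hx => h x (Or.inl hx),
      ih₂ hφ.2 u σ τ fun x hx => h x (Or.inr hx)]
  | assign x a φ ih =>
    intro u σ τ h
    simp only [Sat]
    rw [ih hφ u (Function.update σ x a) (Function.update τ x a)]
    intro y hy
    by_cases hyx : y = x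
    · subst hyx; simp
    · simpa [hyx] using h y ⟨hy, hyx⟩
  | know S α ih =>
    intro u σ τ h
    have hS : σ '' (S : Set X) = τ '' (S : Set X) := Set.image_congr h
    simp only [Sat, hS]
    refine forall₂_congr fun v _ => ih hφ.1 v σ τ ?_
    simp [hφ.2]

/-- Satisfiability at a world of some quasi-model. -/
def Satisfiable (α : Form A P X) : Prop :=
  ∃ M : QuasiModel.{uA, uP, w} A P, ∃ u : M.W, ∃ σ : X → A, M.Sat u σ α

/-! ### Unravelling of quasi-models -/

section Unravelling

-- Groups are listed by an index in `Type`, so that paths stay in the universe of the worlds.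
variable (M : QuasiModel.{uA, uP, w} A P) (r : M.W) {ι : Type} (e : ι → Set A)

/-- The last world of a path from `r`; a path is the list of its steps, the last step first. -/
def tip : List (ι × M.W) → M.W
  | [] => r
  | s :: _ => s.2

/-- Every step `(i, t)` of the path follows the relation for the set of agents `e i`. -/
def IsPath : List (ι × M.W) → Prop
  | [] => True
  | s :: l => IsPath l ∧ M.R (e s.1) (M.tip r l) s.2

open Classical in
/-- Remove the final steps that the agent `a` cannot notice. -/
noncomputable def strip (a : A) (l : List (ι × M.W)) : List (ι × M.W) :=
  l.dropWhile (fun s => decide (a ∈ e s.1))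

variable {M r e}

theorem R_tip_of_forall_subset {B : Set A} {l₂ : List (ι × M.W)} :
    ∀ {l₁ : List (ι × M.W)}, M.IsPath r e (l₁ ++ l₂) → (∀ s ∈ l₁, B ⊆ e s.1) →
      B ⊆ M.dom (M.tip r (l₁ ++ l₂)) → M.R B (M.tip r (l₁ ++ l₂)) (M.tip r l₂)
  | [], _, _, hB => M.refl hB
  | s :: l, hp, hl, _ => by
    have h : M.R B (M.tip r (l ++ l₂)) s.2 := M.mono (hl s (by simp)) hp.2
    exact M.trans (M.symm h) (R_tip_of_forall_subset hp.1
      (fun s' hs' => hl s' (by simp [hs'])) (M.subset_dom h))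

theorem forall_mem_takeWhile_of_length_dropWhile_le {α : Type*} {p q : α → Bool} :
    ∀ {l : List α}, (l.dropWhile q).length ≤ (l.dropWhile p).length →
      ∀ s ∈ l.takeWhile p, q s = true
  | [], _ => by simp
  | x :: l, h => by
    by_cases hp : p x = true
    · have hle := (List.dropWhile_suffix p (l := l)).length_le
      by_cases hq : q x = true
      · simp only [List.dropWhile_cons, hp, hq, if_true] at h
        intro s hs
        simp only [List.takeWhile_cons, hp, if_true, List.mem_cons] at hs
        rcases hs with rfl | hs
        · exact hq
        · exact forall_mem_takeWhile_of_length_dropWhile_le h s hs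
      · simp only [List.dropWhile_cons, hp, hq, if_true, List.length_cons, Bool.false_eq_true,
          if_false] at h
        omega
    · simp [hp]

-- Among the agents of `B`, choose `a` with the longest stripped path. Every step deleted for `a` is
-- then deleted for all of `B`, so its group includes `B`. By monotonicity `R B` joins each tip to
-- the tip of the stripped path, which is common to `l` and `l'`.
open Classical in
theorem R_tip_of_strip_eq [Finite A] {B : Set A} (hB : B.Nonempty) {l l' : List (ι × M.W)}
    (hl : M.IsPath r e l) (hl' : M.IsPath r e l') (hd : B ⊆ M.dom (M.tip r l))
    (hd' : B ⊆ M.dom (M.tip r l')) (h : ∀ a ∈ B, M.strip e a l = M.strip e a l') :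
    M.R B (M.tip r l) (M.tip r l') := by
  obtain ⟨a, haB, ha⟩ := Set.exists_max_image B (fun a => (M.strip e a l).length) (Set.toFinite B) hB
  have key : ∀ k : List (ι × M.W), M.IsPath r e k → B ⊆ M.dom (M.tip r k) →
      (∀ b ∈ B, (M.strip e b k).length ≤ (M.strip e a k).length) →
      M.R B (M.tip r k) (M.tip r (M.strip e a k)) := by
    intro k hk hkd hle
    have hsplit : k.takeWhile (fun s => decide (a ∈ e s.1)) ++ M.strip e a k = k :=
      List.takeWhile_append_dropWhile
    have := R_tip_of_forall_subset (M := M) (r := r) (e := e) (B := B) (l₂ := M.strip e a k)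
      (l₁ := k.takeWhile (fun s => decide (a ∈ e s.1)))
    rw [hsplit] at this
    refine this hk (fun s hs b hb => ?_) hkd
    have := forall_mem_takeWhile_of_length_dropWhile_le (q := fun s : ι × M.W => decide (b ∈ e s.1))
      (p := fun s => decide (a ∈ e s.1)) (l := k) (by simpa only [strip] using hle b hb) s hs
    simpa using this
  have h₁ := key l hl hd ha
  have h₂ := key l' hl' hd' (fun b hb => by rw [← h b hb, ← h a haB]; exact ha b hb)
  rw [← h a haB] at h₂
  exact M.trans h₁ (M.symm h₂)

/-- In a Kripke model `K_∅` is the universal modality, while `R ∅` may have several classes. Paths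
from `r` reach only the class of `r`. -/
theorem R_empty_tip : ∀ {l : List (ι × M.W)}, M.IsPath r e l → M.R ∅ r (M.tip r l)
  | [], _ => M.refl (Set.empty_subset _)
  | _ :: _, h => M.trans (R_empty_tip h.1) (M.mono (Set.empty_subset _) h.2)

variable (M r e)

/-- The Kripke model of the paths from `r`. -/
noncomputable def unravelling : KripkeModel.{uA, uP, w} A P where
  W := {l : List (ι × M.W) // M.IsPath r e l}
  nonempty := ⟨⟨[], trivial⟩⟩
  dom l := M.dom (M.tip r l.1)
  dom_nonempty _ := M.dom_nonempty _
  R a l l' := a ∈ M.dom (M.tip r l.1) ∧ a ∈ M.dom (M.tip r l'.1) ∧ M.strip e a l.1 = M.strip e a l'.1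
  R_empty _ _ h _ h' := h h'.1
  interp p l := M.interp p (M.tip r l.1)
  interp_subset p _ := M.interp_subset p _

variable {M r e}

theorem R_tip_of_forall_R [Finite A] {B : Set A} {l l' : (M.unravelling r e).W}
    (h : ∀ a ∈ B, (M.unravelling r e).R a l l') : M.R B (M.tip r l.1) (M.tip r l'.1) := by
  rcases B.eq_empty_or_nonempty with rfl | hB
  · exact M.trans (M.symm (R_empty_tip l.2)) (R_empty_tip l'.2)
  · exact R_tip_of_strip_eq hB l.2 l'.2 (fun a ha => (h a ha).1) (fun a ha => (h a ha).2.1)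
      fun a ha => (h a ha).2.2

theorem isLocalEpistemic_unravelling [Finite A] : (M.unravelling r e).IsLocalEpistemic where
  local_S5 a :=
    ⟨fun u => ⟨u.2, u.2, rfl⟩, fun h => ⟨h.2.1, h.1, h.2.2.symm⟩,
      fun h h' => ⟨h.1, h'.2.1, h.2.2.trans h'.2.2⟩⟩
  individually_increasing _ _ _ _ h := h.2.1
  local_predicates p u v a ha h :=
    M.local_predicates (B := {a}) (R_tip_of_forall_R (by simpa using h)) rfl ha
  collectively_decreasing _ _ h := M.decreasing (R_tip_of_forall_R h) subset_rfl

theorem sat_unravelling [Finite A] (he : e.Surjective) (φ : Form A P X) : ∀ (l : (M.unravelling r e).W) (σ : X → A),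
    (M.unravelling r e).Sat l σ φ ↔ M.Sat (M.tip r l.1) σ φ := by
  induction φ with
  | atom p x => intro l σ; rfl
  | top => intro l σ; rfl
  | neg φ ih => intro l σ; simp only [Sat, KripkeModel.Sat, ih]
  | and φ ψ ih₁ ih₂ => intro l σ; simp only [Sat, KripkeModel.Sat, ih₁, ih₂]
  | assign x a φ ih => intro l σ; simp only [Sat, KripkeModel.Sat, ih]; rfl
  | know S α ih =>
    intro l σ
    simp only [Sat, KripkeModel.Sat, ih]
    constructor
    · intro h v hv
      obtain ⟨i, hi⟩ := he (σ '' (S : Set X))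
      -- One more step labelled by the group itself reaches `v` and is deleted by `strip` for each
      -- of its members.
      refine h ⟨(i, v) :: l.1, l.2, hi ▸ hv⟩ fun a ha => ⟨M.subset_dom hv ha,
        M.subset_dom (M.symm hv) ha, ?_⟩
      classical
      rw [← hi] at ha
      simp only [strip, List.dropWhile_cons, decide_eq_true ha, if_true]
    · intro h v hv
      exact h _ (R_tip_of_forall_R hv)

end Unravelling

theorem Satisfiable.localEpistemicSatisfiable [Finite A] {α : Form A P X}
    (h : Satisfiable.{uA, uP, uX, w} α) : Form.LocalEpistemicSatisfiable.{uA, uP, uX, w} α := by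
  obtain ⟨M, u, σ, hu⟩ := h
  obtain ⟨n, ⟨f⟩⟩ := Finite.exists_equiv_fin (Set A)
  exact ⟨M.unravelling u f.symm, isLocalEpistemic_unravelling, ⟨[], trivial⟩, σ,
    (sat_unravelling f.symm.surjective α _ σ).2 hu⟩

end QuasiModel

/-! ### Local epistemic models and simplicial models -/

variable {A : Type uA} {P : Type uP} {X : Type uX} [DecidableEq X]

namespace KripkeModel

section LocalEpistemic

variable {M : KripkeModel.{uA, uP, w} A P}

theorem dom_left {a : A} {u v : M.W} (h : M.R a u v) : a ∈ M.dom u :=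
  by_contra fun ha => M.R_empty a u ha v h

namespace IsLocalEpistemic

theorem dom_right (hM : M.IsLocalEpistemic) {a : A} {u v : M.W} (h : M.R a u v) : a ∈ M.dom v :=
  hM.individually_increasing u v a (dom_left h) h

theorem refl (hM : M.IsLocalEpistemic) {a : A} {u : M.W} (ha : a ∈ M.dom u) : M.R a u u :=
  (hM.local_S5 a).refl ⟨u, ha⟩

theorem symm (hM : M.IsLocalEpistemic) {a : A} {u v : M.W} (h : M.R a u v) : M.R a v u :=
  (hM.local_S5 a).symm (x := ⟨u, dom_left h⟩) (y := ⟨v, hM.dom_right h⟩) h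

theorem trans (hM : M.IsLocalEpistemic) {a : A} {u v z : M.W} (h : M.R a u v) (h' : M.R a v z) : M.R a u z :=
  (hM.local_S5 a).trans (x := ⟨u, dom_left h⟩) (y := ⟨v, dom_left h'⟩)
    (z := ⟨z, hM.dom_right h'⟩) h h'

/-- A local epistemic model as a quasi-model. -/
def toQuasiModel (hM : M.IsLocalEpistemic) : QuasiModel.{uA, uP, w} A P where
  W := M.W
  dom := M.dom
  dom_nonempty := M.dom_nonempty
  R B u v := ∀ a ∈ B, M.R a u v
  interp := M.interp
  interp_subset := M.interp_subset
  subset_dom h a ha := dom_left (h a ha)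
  refl h _ ha := hM.refl (h ha)
  symm h a ha := hM.symm (h a ha)
  trans h h' a ha := hM.trans (h a ha) (h' a ha)
  mono hBC h a ha := h a (hBC ha)
  local_predicates h ha hp := hM.local_predicates _ _ _ _ hp (h _ ha)
  decreasing {_ u v} h hB := (hM.collectively_decreasing u v fun a ha => h a (hB ha)).trans hB

theorem sat_toQuasiModel (hM : M.IsLocalEpistemic) (φ : Form A P X) : ∀ (u : M.W) (σ : X → A),
    hM.toQuasiModel.Sat u σ φ ↔ M.Sat u σ φ := by
  induction φ with
  | atom p x => intro l σ; rfl
  | top => intro l σ; rfl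
  | neg φ ih => intro l σ; simp only [QuasiModel.Sat, Sat, ih]
  | and φ ψ ih₁ ih₂ => intro l σ; simp only [QuasiModel.Sat, Sat, ih₁, ih₂]
  | assign x a φ ih => intro l σ; simp only [QuasiModel.Sat, Sat, ih]; rfl
  | know S α ih =>
    intro l σ
    simp only [QuasiModel.Sat, Sat]
    exact forall_congr' fun v => imp_congr Iff.rfl (ih v σ)

end IsLocalEpistemic

/-! ### The simplicial complex of a local epistemic model. -/

variable (M)

/-- The vertices with colour `f.symm i` are the classes of worlds that this agent cannot
distinguish. -/
def Vertex {n : ℕ} (f : A ≃ Fin n) : Type w :=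
  {p : Fin n × Set M.W // ∃ u, M.R (f.symm p.1) u u ∧ p.2 = {v | M.R (f.symm p.1) u v}}

/-- The facet of a world. -/
def facet {n : ℕ} (f : A ≃ Fin n) (u : M.W) : Set (M.Vertex f) := {p | u ∈ p.1.2}

variable {M}

section Facet

variable {n : ℕ} {f : A ≃ Fin n}

theorem IsLocalEpistemic.eq_of_mem_facet (hM : M.IsLocalEpistemic) {p : M.Vertex f} {u : M.W} (hp : p ∈ M.facet f u) :
    p.1.2 = {v | M.R (f.symm p.1.1) u v} := by
  obtain ⟨⟨i, s⟩, z, hz, hs⟩ := p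
  simp only at hs hz
  subst hs
  have hp' : M.R (f.symm i) z u := hp
  ext v
  exact ⟨fun h => hM.trans (hM.symm hp') h, fun h => hM.trans hp' h⟩

theorem IsLocalEpistemic.vertex_ext (hM : M.IsLocalEpistemic) {p q : M.Vertex f} {u : M.W} (hp : p ∈ M.facet f u)
    (hq : q ∈ M.facet f u) (h : f.symm p.1.1 = f.symm q.1.1) : p = q := by
  refine Subtype.ext (Prod.ext (f.symm.injective h) ?_)
  rw [hM.eq_of_mem_facet hp, hM.eq_of_mem_facet hq, h]

/-- A common vertex with colour `a` is a common class of `R a`. This translates the knowledge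
clause; the case `u = v` translates domains. -/
theorem IsLocalEpistemic.mem_image_facet_inter (hM : M.IsLocalEpistemic) {u v : M.W} {a : A} :
    a ∈ (fun p : M.Vertex f => f.symm p.1.1) '' (M.facet f u ∩ M.facet f v) ↔ M.R a u v := by
  constructor
  · rintro ⟨p, ⟨hu, hv⟩, rfl⟩
    have : v ∈ p.1.2 := hv
    rwa [hM.eq_of_mem_facet hu] at this
  · intro h
    exact ⟨⟨(f a, {z | M.R a u z}), u, by simpa using hM.refl (dom_left h), by simp⟩,
      ⟨hM.refl (dom_left h), h⟩, by simp⟩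

theorem IsLocalEpistemic.mem_image_facet (hM : M.IsLocalEpistemic) {u : M.W} {a : A} :
    a ∈ (fun p : M.Vertex f => f.symm p.1.1) '' M.facet f u ↔ a ∈ M.dom u := by
  rw [← Set.inter_self (M.facet f u), hM.mem_image_facet_inter]
  exact ⟨dom_left, hM.refl⟩

theorem IsLocalEpistemic.facet_nonempty (hM : M.IsLocalEpistemic) (u : M.W) : (M.facet f u).Nonempty := by
  obtain ⟨a, ha⟩ := M.dom_nonempty u
  obtain ⟨p, hp, -⟩ := (hM.mem_image_facet (f := f)).2 ha
  exact ⟨p, hp⟩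

/-- Inclusion of facets means that no agent alive at `u` distinguishes `v`, so collective decrease
gives `v` no further agents. This makes every `facet` maximal. -/
theorem IsLocalEpistemic.facet_subset_symm (hM : M.IsLocalEpistemic) {u v : M.W} (h : M.facet f u ⊆ M.facet f v) :
    M.facet f v ⊆ M.facet f u := by
  have hR : ∀ a ∈ M.dom u, M.R a u v := fun a ha => by
    rw [← hM.mem_image_facet_inter (f := f), Set.inter_eq_left.2 h]
    exact hM.mem_image_facet.2 ha
  intro p hp
  have hd : f.symm p.1.1 ∈ M.dom u :=
    hM.collectively_decreasing u v hR (hM.mem_image_facet.1 ⟨p, hp, rfl⟩)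
  have : u ∈ {z | M.R (f.symm p.1.1) v z} := hM.symm (hR _ hd)
  rwa [← hM.eq_of_mem_facet hp] at this

variable (f)

/-- The simplicial model of a local epistemic model. -/
def IsLocalEpistemic.toSimplicialModel (hM : M.IsLocalEpistemic) : SimplicialModel.{uA, uP, w} A P where
  V := M.Vertex f
  nonempty := by
    obtain ⟨u⟩ := M.nonempty
    exact (hM.facet_nonempty (f := f) u).to_subtype.map Subtype.val
  faces := {Y | Y.Nonempty ∧ ∃ u, Y ⊆ M.facet f u}
  empty_notMem h := Set.not_nonempty_empty h.1
  down_closed := fun _ ⟨_, u, hu⟩ _ hY hYF => ⟨hY, u, hYF.trans hu⟩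
  singleton_mem := by
    intro v
    obtain ⟨u, hu, hv⟩ := v.2
    refine ⟨Set.singleton_nonempty v, u, ?_⟩
    intro q hq
    rw [Set.mem_singleton_iff.1 hq]
    change u ∈ v.1.2
    rw [hv]
    exact hu
  color p := f.symm p.1.1
  color_injOn := fun _ ⟨_, _, hu⟩ _ hp _ hq h => hM.vertex_ext (hu hp) (hu hq) h
  label p := {v | ∃ u ∈ v.1.2, f.symm v.1.1 ∈ M.interp p u}

theorem IsLocalEpistemic.facets_toSimplicialModel (hM : M.IsLocalEpistemic) :
    (hM.toSimplicialModel f).facets = Set.range (M.facet f) := by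
  ext F
  constructor
  · rintro ⟨⟨hF, u, hu⟩, hmax⟩
    refine ⟨u, by_contra fun hne => hmax (M.facet f u) ⟨⟨hM.facet_nonempty u, u, subset_rfl⟩, hne⟩ hu⟩
  · rintro ⟨u, rfl⟩
    refine ⟨⟨hM.facet_nonempty u, u, subset_rfl⟩, fun Y hY hu => hY.2 ?_⟩
    obtain ⟨⟨_, v, hv⟩, -⟩ := hY
    exact (hv.trans (hM.facet_subset_symm (hu.trans hv))).antisymm hu

theorem IsLocalEpistemic.sat_toSimplicialModel (hM : M.IsLocalEpistemic) (φ : Form A P X) : ∀ (u : M.W) (σ : X → A),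
    (hM.toSimplicialModel f).Sat (M.facet f u) σ φ ↔ M.Sat u σ φ := by
  induction φ with
  | atom p x =>
    intro u σ
    constructor
    · rintro ⟨v, ⟨hv, z, hz, hp⟩, hx⟩
      have hx' : f.symm v.1.1 = σ x := hx
      rw [hM.eq_of_mem_facet hv] at hz
      rw [hx'] at hz hp
      exact hM.local_predicates p z u _ hp (hM.symm hz)
    · intro h
      obtain ⟨v, hv, hx⟩ := (hM.mem_image_facet (f := f)).2 (M.interp_subset p u h)
      exact ⟨v, ⟨hv, u, hv, by
        have hx' : f.symm v.1.1 = σ x := hx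
        rw [hx']
        exact h⟩, hx⟩
  | top => intro u σ; rfl
  | neg φ ih => intro u σ; simp only [SimplicialModel.Sat, Sat, ih]
  | and φ ψ ih₁ ih₂ => intro u σ; simp only [SimplicialModel.Sat, Sat, ih₁, ih₂]
  | assign x a φ ih =>
    intro u σ
    simp only [SimplicialModel.Sat, Sat, ih]
    exact imp_congr hM.mem_image_facet Iff.rfl
  | know S α ih =>
    intro u σ
    simp only [SimplicialModel.Sat, Sat, hM.facets_toSimplicialModel]
    refine Set.forall_mem_range.trans (forall_congr' fun v => imp_congr ?_ (ih v σ))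
    exact forall₂_congr fun a _ => hM.mem_image_facet_inter

end Facet

end LocalEpistemic

end KripkeModel

/-! ### The local epistemic model of the facets of a simplicial model. -/

namespace SimplicialModel

variable (C : SimplicialModel.{uA, uP, w} A P)

theorem nonempty_of_mem_facets {F : Set C.V} (hF : F ∈ C.facets) : F.Nonempty :=
  Set.nonempty_iff_ne_empty.2 fun h => C.empty_notMem (h ▸ hF.1)

/-- The Kripke model of the facets of a simplicial model. -/
def toKripkeModel (h : C.facets.Nonempty) : KripkeModel.{uA, uP, w} A P where
  W := C.facets
  nonempty := h.to_subtype
  dom F := C.color '' F.1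
  dom_nonempty F := (C.nonempty_of_mem_facets F.2).image _
  R a F G := a ∈ C.color '' (F.1 ∩ G.1)
  R_empty _ _ ha _ h := ha (Set.image_mono Set.inter_subset_left h)
  interp p F := C.color '' (F.1 ∩ C.label p)
  interp_subset _ _ := Set.image_mono Set.inter_subset_left

theorem isLocalEpistemic_toKripkeModel (h : C.facets.Nonempty) :
    (C.toKripkeModel h).IsLocalEpistemic where
  local_S5 a := by
    refine ⟨fun u => ?_, fun {u v} h => ?_, fun {u v z} h h' => ?_⟩
    · change a ∈ C.color '' (u.1.1 ∩ u.1.1)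
      rw [Set.inter_self]
      exact u.2
    · change a ∈ C.color '' (v.1.1 ∩ u.1.1)
      rw [Set.inter_comm]
      exact h
    · obtain ⟨p, hp, rfl⟩ := h
      obtain ⟨q, hq, hpq⟩ := h'
      obtain rfl := C.color_injOn _ v.1.2.1 hq.1 hp.2 hpq
      exact ⟨q, ⟨hp.1, hq.2⟩, rfl⟩
  individually_increasing _ _ _ _ h := Set.image_mono Set.inter_subset_right h
  local_predicates p u v a ha h := by
    obtain ⟨x, hx, rfl⟩ := ha
    obtain ⟨y, hy, hxy⟩ := h
    obtain rfl := C.color_injOn _ u.2.1 hy.1 hx.1 hxy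
    exact ⟨y, ⟨hy.2, hx.2⟩, rfl⟩
  collectively_decreasing u v h := by
    have huv : u.1 ⊆ v.1 := fun x hx => by
      obtain ⟨y, hy, hxy⟩ := h _ ⟨x, hx, rfl⟩
      obtain rfl := C.color_injOn _ u.2.1 hy.1 hx hxy
      exact hy.2
    -- Sharing all colours of `u` means containing `u`, and `u` is a maximal face.
    have : v.1 = u.1 := by_contra fun hne => u.2.2 v.1 ⟨v.2.1, hne⟩ huv
    exact (congrArg (C.color '' ·) this).subset

theorem sat_toKripkeModel (h : C.facets.Nonempty) (φ : Form A P X) :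
    ∀ (F : C.facets) (σ : X → A), (C.toKripkeModel h).Sat F σ φ ↔ C.Sat F.1 σ φ := by
  induction φ with
  | atom p x => intro u σ; rfl
  | top => intro u σ; rfl
  | neg φ ih => intro u σ; simp only [SimplicialModel.Sat, KripkeModel.Sat, ih]
  | and φ ψ ih₁ ih₂ => intro u σ; simp only [SimplicialModel.Sat, KripkeModel.Sat, ih₁, ih₂]
  | assign x a φ ih => intro u σ; simp only [SimplicialModel.Sat, KripkeModel.Sat, ih]; rfl
  | know S α ih =>
    intro u σ
    simp only [SimplicialModel.Sat, KripkeModel.Sat]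
    exact ⟨fun h G hG hS => (ih ⟨G, hG⟩ σ).1 (h ⟨G, hG⟩ hS),
      fun h v hv => (ih v σ).2 (h v.1 v.2 hv)⟩

end SimplicialModel

/-! ### Equivalence of the three notions of satisfiability. -/

theorem Form.localEpistemicSatisfiable_iff_satisfiable [Finite A] {α : Form A P X} :
    Form.LocalEpistemicSatisfiable.{uA, uP, uX, w} α ↔
      QuasiModel.Satisfiable.{uA, uP, uX, w} α :=
  ⟨fun ⟨_, hM, u, σ, h⟩ => ⟨hM.toQuasiModel, u, σ, (hM.sat_toQuasiModel α u σ).2 h⟩,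
    QuasiModel.Satisfiable.localEpistemicSatisfiable⟩

theorem Form.simplicialSatisfiable_iff_localEpistemicSatisfiable [Finite A] {α : Form A P X} :
    Form.SimplicialSatisfiable.{uA, uP, uX, w} α ↔
      Form.LocalEpistemicSatisfiable.{uA, uP, uX, w} α := by
  constructor
  · rintro ⟨C, F, hF, σ, h⟩
    exact ⟨C.toKripkeModel ⟨F, hF⟩, C.isLocalEpistemic_toKripkeModel _, ⟨F, hF⟩, σ,
      (C.sat_toKripkeModel ⟨F, hF⟩ α ⟨F, hF⟩ σ).2 h⟩
  · rintro ⟨M, hM, u, σ, h⟩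
    -- Numbered agents keep the vertices in the universe of the worlds.
    obtain ⟨n, ⟨f⟩⟩ := Finite.exists_equiv_fin A
    refine ⟨hM.toSimplicialModel f, M.facet f u, ?_, σ, (hM.sat_toSimplicialModel f α u σ).2 h⟩
    rw [hM.facets_toSimplicialModel]
    exact ⟨u, rfl⟩

/-! ### Bounded quantifiers and primitive recursion -/

section Primrec

variable {E : Type*} [Primcodable E]

theorem primrec_fst {F G : Type*} [Primcodable F] [Primcodable G] {f : E → F × G}
    (hf : Primrec f) : Primrec fun e => (f e).1 := Primrec.fst.comp hf

theorem primrec_snd {F G : Type*} [Primcodable F] [Primcodable G] {f : E → F × G}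
    (hf : Primrec f) : Primrec fun e => (f e).2 := Primrec.snd.comp hf

theorem primrec_natPair {f g : E → ℕ} (hf : Primrec f) (hg : Primrec g) :
    Primrec fun e => Nat.pair (f e) (g e) := Primrec₂.natPair.comp hf hg

theorem primrec_add {f g : E → ℕ} (hf : Primrec f) (hg : Primrec g) :
    Primrec fun e => f e + g e := Primrec.nat_add.comp hf hg

theorem primrec_div {f g : E → ℕ} (hf : Primrec f) (hg : Primrec g) :
    Primrec fun e => f e / g e := Primrec.nat_div.comp hf hg

theorem primrec_mod {f g : E → ℕ} (hf : Primrec f) (hg : Primrec g) :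
    Primrec fun e => f e % g e := Primrec.nat_mod.comp hf hg

theorem primrec_pow {f g : E → ℕ} (hf : Primrec f) (hg : Primrec g) :
    Primrec fun e => f e ^ g e :=
  (Primrec₂.unpaired'.1 Nat.Primrec.pow).comp hf hg

-- With these rules `fun_prop` treats the arithmetic terms, and a predicate built with bounded
-- quantifiers is primitive recursive by its shape.
attribute [fun_prop] Primrec Primrec.id Primrec.const Primrec.comp Primrec.pair Primrec.fst
  Primrec.snd primrec_fst primrec_snd primrec_natPair primrec_add primrec_div primrec_mod
  primrec_pow

theorem primrecPred_eq {f g : E → ℕ} (hf : Primrec f) (hg : Primrec g) :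
    PrimrecPred fun e => f e = g e := Primrec.eq.comp hf hg

theorem primrecPred_lt {f g : E → ℕ} (hf : Primrec f) (hg : Primrec g) :
    PrimrecPred fun e => f e < g e := Primrec.nat_lt.comp hf hg

theorem primrecPred_testBit {f g : E → ℕ} (hf : Primrec f) (hg : Primrec g) :
    PrimrecPred fun e => (f e).testBit (g e) = true :=
  (primrecPred_eq (f := fun e => f e / 2 ^ g e % 2) (g := fun _ => 1) (by fun_prop)
    (by fun_prop)).of_eq fun e => by simp [Nat.testBit_eq_decide_div_mod_eq]

theorem primrecPred_imp {p q : E → Prop} (hp : PrimrecPred p) (hq : PrimrecPred q) :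
    PrimrecPred fun e => p e → q e :=
  (hp.not.or hq).of_eq fun e => by tauto

theorem primrecPred_iff {p q : E → Prop} (hp : PrimrecPred p) (hq : PrimrecPred q) :
    PrimrecPred fun e => p e ↔ q e :=
  ((primrecPred_imp hp hq).and (primrecPred_imp hq hp)).of_eq fun e => by tauto

theorem primrecPred_forall_lt {f : E → ℕ} {R : E → ℕ → Prop} (hf : Primrec f)
    (hR : PrimrecPred fun p : E × ℕ => R p.1 p.2) :
    PrimrecPred fun e => ∀ x < f e, R e x := by
  have h : PrimrecRel fun (x : ℕ) (e : E) => R e x := hR.comp (Primrec.snd.pair Primrec.fst)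
  exact (h.forall_mem_list.comp (Primrec.list_range.comp hf) Primrec.id).of_eq (by simp)

theorem primrecPred_exists_lt {f : E → ℕ} {R : E → ℕ → Prop} (hf : Primrec f)
    (hR : PrimrecPred fun p : E × ℕ => R p.1 p.2) :
    PrimrecPred fun e => ∃ x < f e, R e x := by
  have h : PrimrecRel fun (x : ℕ) (e : E) => R e x := hR.comp (Primrec.snd.pair Primrec.fst)
  exact (h.exists_mem_list.comp (Primrec.list_range.comp hf) Primrec.id).of_eq (by simp)

theorem primrecPred_mem_range_encode (α : Type*) [Primcodable α] {f : E → ℕ} (hf : Primrec f) :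
    PrimrecPred fun e => f e ∈ Set.range (Encodable.encode : α → ℕ) :=
  Primcodable.mem_range_encode.comp hf

end Primrec

/-! ### Bit sets and digits -/

theorem exists_lt_two_pow_testBit (N : ℕ) (p : ℕ → Prop) :
    ∃ t < 2 ^ N, ∀ i < N, (t.testBit i = true ↔ p i) := by
  classical
  refine ⟨Nat.ofBits fun i : Fin N => decide (p i), Nat.ofBits_lt_two_pow _, fun i hi => ?_⟩
  simp [Nat.testBit_ofBits_lt _ _ hi]

/-- The digit number `x` of `s` in base `k`. -/
def digit (k s x : ℕ) : ℕ := s / k ^ x % k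

theorem exists_lt_pow_digit {k : ℕ} (N : ℕ) (g : ℕ → ℕ) (hg : ∀ i, g i < k) :
    ∃ s < k ^ N, ∀ i < N, digit k s i = g i := by
  refine ⟨finFunctionFinEquiv fun i : Fin N => (⟨g i, hg i⟩ : Fin k), Fin.is_lt _, fun i hi => ?_⟩
  rw [digit, ← finFunctionFinEquiv_symm_apply_val (n := N) _ ⟨i, hi⟩, Equiv.symm_apply_apply]

theorem testBit_sum_two_pow_encode {X : Type uX} [Encodable X] (S : Finset X) (i : ℕ) :
    (∑ x ∈ S, 2 ^ Encodable.encode x).testBit i = true ↔ ∃ x ∈ S, Encodable.encode x = i := by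
  have h : ∑ x ∈ S, 2 ^ Encodable.encode x =
      ∑ i ∈ S.map ⟨Encodable.encode, Encodable.encode_injective⟩, 2 ^ i := by
    rw [Finset.sum_map]; rfl
  rw [h, ← Nat.mem_bitIndices, ← List.mem_toFinset, Finset.toFinset_bitIndices_sum_two_pow]
  simp

theorem exists_finset_sum_two_pow_encode {X : Type uX} [Encodable X] {m : ℕ}
    (h : ∀ i, m.testBit i = true → i ∈ Set.range (Encodable.encode : X → ℕ)) :
    ∃ S : Finset X, ∑ x ∈ S, 2 ^ Encodable.encode x = m := by
  classical
  refine ⟨m.bitIndices.toFinset.preimage Encodable.encode Encodable.encode_injective.injOn, ?_⟩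
  rw [Finset.sum_preimage Encodable.encode _ _ (fun i => 2 ^ i)]
  · exact Finset.sum_toFinset_bitIndices_two_pow m
  · intro i hi hn
    exact absurd (h i (by simpa using hi)) hn

theorem lt_of_testBit {m i : ℕ} (h : m.testBit i = true) : i < m :=
  Nat.lt_two_pow_self.trans_le (Nat.ge_two_pow_of_testBit h)

theorem pair_le_pair {a b c d : ℕ} (h₁ : a ≤ c) (h₂ : b ≤ d) : Nat.pair a b ≤ Nat.pair c d :=
  ((StrictMono.monotone fun _ _ h => Nat.pair_lt_pair_left b h) h₁).trans
    ((StrictMono.monotone fun _ _ h => Nat.pair_lt_pair_right c h) h₂)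

/-! ### Recognizing codes of formulas and of sentences -/

section Codes

variable (A : Type uA) (P : Type uP) (X : Type uX)

section Encodable

variable [Encodable A] [Encodable P] [Encodable X]

/-- The codes of formulas. -/
def IsFormulaCode (m : ℕ) : Prop := ∃ φ : Form A P X, φ.IsFormula ∧ φ.code = m

/-- The codes of sentences. -/
def IsSentenceCode (m : ℕ) : Prop := ∃ φ : Form A P X, φ.IsSentence ∧ φ.code = m

/-- The bit set `g` consists of codes of formulas up to `n`, and the bit set `f` of the pairs of
such a code and the code of a free variable. -/
def IsFormulaCertificate (n g f : ℕ) : Prop :=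
  ∀ m < n + 1, g.testBit m →
    (∃ p < n + 1, ∃ x < n + 1, m = Nat.pair 0 (Nat.pair p x) ∧
      p ∈ Set.range (Encodable.encode : P → ℕ) ∧ x ∈ Set.range (Encodable.encode : X → ℕ) ∧
      ∀ y < n + 1, f.testBit (Nat.pair m y) ↔ y = x) ∨
    (m = Nat.pair 1 0 ∧ ∀ y < n + 1, ¬ f.testBit (Nat.pair m y)) ∨
    (∃ r < n + 1, m = Nat.pair 2 r ∧ g.testBit r ∧
      ∀ y < n + 1, f.testBit (Nat.pair m y) ↔ f.testBit (Nat.pair r y)) ∨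
    (∃ r < n + 1, ∃ r' < n + 1, m = Nat.pair 3 (Nat.pair r r') ∧ g.testBit r ∧ g.testBit r' ∧
      ∀ y < n + 1, f.testBit (Nat.pair m y) ↔
        (f.testBit (Nat.pair r y) ∨ f.testBit (Nat.pair r' y))) ∨
    (∃ x < n + 1, ∃ a < n + 1, ∃ r < n + 1, m = Nat.pair 4 (Nat.pair (Nat.pair x a) r) ∧
      x ∈ Set.range (Encodable.encode : X → ℕ) ∧ a ∈ Set.range (Encodable.encode : A → ℕ) ∧
      g.testBit r ∧
      ∀ y < n + 1, f.testBit (Nat.pair m y) ↔ (f.testBit (Nat.pair r y) ∧ ¬ y = x)) ∨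
    (∃ s < n + 1, ∃ r < n + 1, m = Nat.pair 5 (Nat.pair s r) ∧ g.testBit r ∧
      (∀ y < n + 1, s.testBit y → y ∈ Set.range (Encodable.encode : X → ℕ)) ∧
      (∀ y < n + 1, ¬ f.testBit (Nat.pair r y)) ∧
      ∀ y < n + 1, f.testBit (Nat.pair m y) ↔ s.testBit y)

end Encodable

theorem primrecPred_isFormulaCertificate [Primcodable A] [Primcodable P] [Primcodable X] {E : Type*} [Primcodable E] {n g f : E → ℕ}
    (hn : Primrec n) (hg : Primrec g) (hf : Primrec f) :
    PrimrecPred fun e => IsFormulaCertificate A P X (n e) (g e) (f e) := by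
  unfold IsFormulaCertificate
  repeat' first
    | refine primrecPred_forall_lt (by fun_prop) ?_
    | refine primrecPred_exists_lt (by fun_prop) ?_
    | refine PrimrecPred.and ?_ ?_
    | refine PrimrecPred.or ?_ ?_
    | refine PrimrecPred.not ?_
    | refine primrecPred_testBit (by fun_prop) (by fun_prop)
    | refine primrecPred_eq (by fun_prop) (by fun_prop)
    | refine primrecPred_mem_range_encode _ (by fun_prop)
    | refine primrecPred_iff ?_ ?_
    | refine primrecPred_imp ?_ ?_

end Codes

/-- This bound lets quantifiers over free variables stop at the code of the formula, and lets `n +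
1` digits represent an assignment. -/
theorem Form.encode_le_code_of_mem_FV {A : Type uA} {P : Type uP} {X : Type uX}
    [Encodable A] [Encodable P] [Encodable X] :
    ∀ {φ : Form A P X} {x : X}, x ∈ φ.FV → Encodable.encode x ≤ φ.code
  | atom p _, x, h => by
    obtain rfl := h
    exact (Nat.right_le_pair _ _).trans (Nat.right_le_pair _ _)
  | neg φ, x, h => (encode_le_code_of_mem_FV (φ := φ) h).trans (Nat.right_le_pair _ _)
  | and φ ψ, x, .inl h => (encode_le_code_of_mem_FV (φ := φ) h).trans
      ((Nat.left_le_pair _ _).trans (Nat.right_le_pair _ _))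
  | and φ ψ, x, .inr h => (encode_le_code_of_mem_FV (φ := ψ) h).trans
      ((Nat.right_le_pair _ _).trans (Nat.right_le_pair _ _))
  | assign _ _ φ, x, h => (encode_le_code_of_mem_FV (φ := φ) h.1).trans
      ((Nat.right_le_pair _ _).trans (Nat.right_le_pair _ _))
  | know S φ, x, h => (lt_of_testBit ((testBit_sum_two_pow_encode S _).2 ⟨x, h, rfl⟩)).le.trans
      ((Nat.left_le_pair _ _).trans (Nat.right_le_pair _ _))

section Codes

variable {A : Type uA} {P : Type uP} {X : Type uX} [Primcodable A] [Primcodable P] [Primcodable X]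

/-- Each clause reduces `m` to smaller codes in `g` and fixes the entries of `f` at `m` from theirs.
Hence a certificate, which need not list all formulas, is always right about those it lists. -/
theorem IsFormulaCertificate.exists_form {n g f : ℕ} (h : IsFormulaCertificate A P X n g f)
    (m : ℕ) : m ≤ n → g.testBit m = true → ∃ φ : Form A P X, φ.IsFormula ∧ φ.code = m ∧
      ∀ y ≤ n, f.testBit (Nat.pair m y) = true ↔ ∃ x ∈ φ.FV, Encodable.encode x = y := by
  induction m using Nat.strong_induction_on with
  | _ m ih =>
  intro hm hg
  -- All constructors with subformulas have a positive tag, so their arguments are strictly smaller.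
  have pos : ∀ {c i}, 0 < c → i < Nat.pair c i := fun {c i} hc =>
    (Nat.right_le_pair 0 i).trans_lt (Nat.pair_lt_pair_left i hc)
  rcases h m (by omega) hg with ⟨p, -, x, -, rfl, ⟨p, rfl⟩, ⟨x, rfl⟩, hf⟩ | ⟨rfl, hf⟩ |
    ⟨r, -, rfl, hr, hf⟩ | ⟨r, -, r', -, rfl, hr, hr', hf⟩ |
    ⟨x, -, a, -, r, -, rfl, ⟨x, rfl⟩, ⟨a, rfl⟩, hr, hf⟩ | ⟨s, hsn, r, -, rfl, hr, hs, hfr, hf⟩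
  · refine ⟨.atom p x, trivial, rfl, fun y hy => ?_⟩
    rw [hf y (by omega)]
    simp [Form.FV, eq_comm]
  · refine ⟨.top, trivial, rfl, fun y hy => ?_⟩
    have := hf y (by omega)
    simp [Form.FV, this]
  · have hlt := pos (c := 2) (i := r) (by omega)
    obtain ⟨φ, hφ, rfl, hφf⟩ := ih r hlt (by omega) hr
    exact ⟨.neg φ, hφ, rfl, fun y hy => (hf y (by omega)).trans (hφf y hy)⟩
  · have hlt := pos (c := 3) (i := Nat.pair r r') (by omega)
    have h₁ := Nat.left_le_pair r r'
    have h₂ := Nat.right_le_pair r r'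
    obtain ⟨φ, hφ, rfl, hφf⟩ := ih r (by omega) (by omega) hr
    obtain ⟨ψ, hψ, rfl, hψf⟩ := ih r' (by omega) (by omega) hr'
    refine ⟨.and φ ψ, ⟨hφ, hψ⟩, rfl, fun y hy => ?_⟩
    rw [hf y (by omega), hφf y hy, hψf y hy]
    simp only [Form.FV, Set.mem_union, or_and_right, exists_or]
  · have hlt := pos (c := 4) (i := Nat.pair (Nat.pair (Encodable.encode x) (Encodable.encode a)) r)
      (by omega)
    have h₂ := Nat.right_le_pair (Nat.pair (Encodable.encode x) (Encodable.encode a)) r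
    obtain ⟨φ, hφ, rfl, hφf⟩ := ih r (by omega) (by omega) hr
    refine ⟨.assign x a φ, hφ, rfl, fun y hy => ?_⟩
    rw [hf y (by omega), hφf y hy]
    constructor
    · rintro ⟨⟨z, hz, rfl⟩, hne⟩
      exact ⟨z, ⟨hz, fun hzx => hne (by rw [hzx])⟩, rfl⟩
    · rintro ⟨z, hz, rfl⟩
      exact ⟨⟨z, hz.1, rfl⟩, fun hzx => hz.2 (Encodable.encode_injective hzx)⟩
  · have hlt := pos (c := 5) (i := Nat.pair s r) (by omega)
    have h₂ := Nat.right_le_pair s r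
    obtain ⟨φ, hφ, rfl, hφf⟩ := ih r (by omega) (by omega) hr
    obtain ⟨S, rfl⟩ := exists_finset_sum_two_pow_encode (X := X) fun i hi =>
      hs i ((lt_of_testBit hi).trans hsn) hi
    refine ⟨.know S φ, ⟨hφ, Set.eq_empty_of_forall_notMem fun x hx => ?_⟩, rfl, fun y hy => ?_⟩
    · have hle := Form.encode_le_code_of_mem_FV hx
      exact hfr _ (by omega) ((hφf _ (by omega)).2 ⟨x, hx, rfl⟩)
    · rw [hf y (by omega), testBit_sum_two_pow_encode]
      rfl

variable (A P X)

/-- The true sets of formula codes and of free-variable pairs, cut off at the bounds, form a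
certificate. Bounded search for certificates is therefore complete. -/
theorem exists_isFormulaCertificate (n : ℕ) : ∃ g < 2 ^ (n + 1), ∃ f < 2 ^ (Nat.pair n n + 1),
    IsFormulaCertificate A P X n g f ∧
      ∀ m ≤ n, (g.testBit m = true ↔ IsFormulaCode A P X m) := by
  obtain ⟨g, hgn, hg⟩ := exists_lt_two_pow_testBit (n + 1) (IsFormulaCode A P X)
  obtain ⟨f, hfn, hf⟩ := exists_lt_two_pow_testBit (Nat.pair n n + 1) fun i =>
    ∃ φ : Form A P X, φ.IsFormula ∧ ∃ x ∈ φ.FV, i = Nat.pair φ.code (Encodable.encode x)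
  have hF : ∀ φ : Form A P X, φ.IsFormula → φ.code ≤ n → ∀ y < n + 1,
      (f.testBit (Nat.pair φ.code y) = true ↔ ∃ x ∈ φ.FV, Encodable.encode x = y) := by
    intro φ hφ hc y hy
    rw [hf _ (Nat.lt_succ_of_le (pair_le_pair hc (by omega)))]
    constructor
    · rintro ⟨ψ, -, x, hx, h⟩
      rw [Nat.pair_eq_pair] at h
      obtain rfl := Form.code_injective h.1
      exact ⟨x, hx, h.2.symm⟩
    · rintro ⟨x, hx, rfl⟩
      exact ⟨φ, hφ, x, hx, rfl⟩
  refine ⟨g, hgn, f, hfn, ?_, fun m hm => hg m (by omega)⟩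
  intro m hm hgm
  obtain ⟨φ, hφ, rfl⟩ := (hg m hm).1 hgm
  have hle : ∀ {c i}, i ≤ Nat.pair c i := fun {c i} => Nat.right_le_pair c i
  have hle' : ∀ {c i}, c ≤ Nat.pair c i := fun {c i} => Nat.left_le_pair c i
  have hG : ∀ ψ : Form A P X, ψ.IsFormula → ψ.code < n + 1 → g.testBit ψ.code = true :=
    fun ψ hψ hlt => (hg _ hlt).2 ⟨ψ, hψ, rfl⟩
  cases φ with
  | atom p x =>
    refine Or.inl ⟨Encodable.encode p, (hle'.trans hle).trans_lt hm, Encodable.encode x,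
      (hle.trans hle).trans_lt hm, rfl, ⟨p, rfl⟩, ⟨x, rfl⟩, fun y hy => ?_⟩
    rw [hF _ hφ (by omega) y hy]
    simp [Form.FV, eq_comm]
  | top =>
    refine Or.inr (Or.inl ⟨rfl, fun y hy => ?_⟩)
    rw [hF _ hφ (by omega) y hy]
    simp [Form.FV]
  | neg φ =>
    have hlt := hle.trans_lt hm
    refine Or.inr (Or.inr (Or.inl ⟨φ.code, hlt, rfl, hG φ hφ hlt, fun y hy => ?_⟩))
    rw [hF _ hφ (by omega) y hy, hF φ hφ (by omega) y hy]
    rfl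
  | and φ ψ =>
    have h₁ := (hle'.trans hle).trans_lt hm
    have h₂ := (hle.trans hle).trans_lt hm
    refine Or.inr (Or.inr (Or.inr (Or.inl ⟨φ.code, h₁, ψ.code, h₂, rfl, hG φ hφ.1 h₁,
      hG ψ hφ.2 h₂, fun y hy => ?_⟩)))
    rw [hF _ hφ (by omega) y hy, hF _ hφ.1 (by omega) y hy, hF _ hφ.2 (by omega) y hy]
    simp only [Form.FV, Set.mem_union, or_and_right, exists_or]
  | assign x a φ =>
    have h₁ := (hle.trans hle).trans_lt hm
    refine Or.inr (Or.inr (Or.inr (Or.inr (Or.inl ⟨Encodable.encode x,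
      ((hle'.trans hle').trans hle).trans_lt hm, Encodable.encode a,
      ((hle.trans hle').trans hle).trans_lt hm, φ.code, h₁, rfl, ⟨x, rfl⟩, ⟨a, rfl⟩, hG φ hφ h₁,
      fun y hy => ?_⟩))))
    rw [hF _ hφ (by omega) y hy, hF φ hφ (by omega) y hy]
    constructor
    · rintro ⟨z, hz, rfl⟩
      exact ⟨⟨z, hz.1, rfl⟩, fun hzx => hz.2 (Encodable.encode_injective hzx)⟩
    · rintro ⟨⟨z, hz, rfl⟩, hne⟩
      exact ⟨z, ⟨hz, fun hzx => hne (by rw [hzx])⟩, rfl⟩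
  | know S φ =>
    have h₁ := (hle.trans hle).trans_lt hm
    refine Or.inr (Or.inr (Or.inr (Or.inr (Or.inr ⟨_, (hle'.trans hle).trans_lt hm, φ.code, h₁,
      rfl, hG φ hφ.1 h₁, fun y hy hS => ?_, fun y hy => ?_, fun y hy => ?_⟩))))
    · obtain ⟨x, -, rfl⟩ := (testBit_sum_two_pow_encode S y).1 hS
      exact ⟨x, rfl⟩
    · rw [hF _ hφ.1 (by omega) y hy, hφ.2]
      simp
    · rw [hF _ hφ (by omega) y hy, testBit_sum_two_pow_encode]
      rfl

theorem primrecPred_isFormulaCode : PrimrecPred (IsFormulaCode A P X) := by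
  have h : PrimrecPred fun n => ∃ g < 2 ^ (n + 1), ∃ f < 2 ^ (Nat.pair n n + 1),
      IsFormulaCertificate A P X n g f ∧ g.testBit n = true :=
    primrecPred_exists_lt (by fun_prop) <| primrecPred_exists_lt (by fun_prop) <|
      (primrecPred_isFormulaCertificate A P X (by fun_prop) (by fun_prop) (by fun_prop)).and
        (primrecPred_testBit (by fun_prop) (by fun_prop))
  refine h.of_eq fun n => ⟨?_, fun hn => ?_⟩
  · rintro ⟨g, -, f, -, h, hg⟩
    obtain ⟨φ, hφ, hc, -⟩ := h.exists_form n le_rfl hg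
    exact ⟨φ, hφ, hc⟩
  · obtain ⟨g, hgn, f, hfn, h, hg⟩ := exists_isFormulaCertificate A P X n
    exact ⟨g, hgn, f, hfn, h, (hg n le_rfl).2 hn⟩

theorem primrecPred_isSentenceCode : PrimrecPred (IsSentenceCode A P X) := by
  have h : PrimrecPred fun n => ∃ g < 2 ^ (n + 1), ∃ f < 2 ^ (Nat.pair n n + 1),
      IsFormulaCertificate A P X n g f ∧ g.testBit n = true ∧
        ∀ y < n + 1, ¬ f.testBit (Nat.pair n y) = true :=
    primrecPred_exists_lt (by fun_prop) <| primrecPred_exists_lt (by fun_prop) <|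
      (primrecPred_isFormulaCertificate A P X (by fun_prop) (by fun_prop) (by fun_prop)).and <|
        (primrecPred_testBit (by fun_prop) (by fun_prop)).and <|
          primrecPred_forall_lt (by fun_prop) (primrecPred_testBit (by fun_prop) (by fun_prop)).not
  refine h.of_eq fun n => ⟨?_, ?_⟩
  · rintro ⟨g, -, f, -, h, hg, hf⟩
    obtain ⟨φ, hφ, hc, hφf⟩ := h.exists_form n le_rfl hg
    refine ⟨φ, ⟨hφ, Set.eq_empty_of_forall_notMem fun x hx => ?_⟩, hc⟩
    have hle := Form.encode_le_code_of_mem_FV hx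
    exact hf _ (by omega) ((hφf _ (by omega)).2 ⟨x, hx, rfl⟩)
  · rintro ⟨φ, hφ, hc⟩
    obtain ⟨g, hgn, f, hfn, h, hg⟩ := exists_isFormulaCertificate A P X n
    have hgn' := (hg n le_rfl).2 ⟨φ, hφ.1, hc⟩
    refine ⟨g, hgn, f, hfn, h, hgn', fun y hy hfy => ?_⟩
    obtain ⟨ψ, -, hc', hψf⟩ := h.exists_form n le_rfl hgn'
    obtain rfl := Form.code_injective (hc'.trans hc.symm)
    obtain ⟨x, hx, -⟩ := (hψf y (by omega)).1 hfy
    rw [hφ.2] at hx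
    exact hx

end Codes

/-! ### Coded types -/

/-- A type, that is the description of a world of a model with agents numbered by `i < k`, is
coded by a bit set `t`. The entry `(c, m, s)` says: for `c = 0`, that the agent `s` is in the
domain; for `c = 1`, that the predicate letter with code `m` holds of the agent `s`; for `c = 2`,
that the sentence with code `m` is known to the group with bit set `s`; for `c = 3`, that the
formula with code `m` holds under the assignment with base `k` digits `s`. -/
def TypeBit (c t m s : ℕ) : Prop := t.testBit (Nat.pair c (Nat.pair m s)) = true

/-- A bound for the entries of types that matter for formulas with code at most `n`. -/
def typeBound (k n : ℕ) : ℕ := Nat.pair 3 (Nat.pair n (k + 2 ^ k + k ^ (n + 1))) + 1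

/-- The relation between types that represents indistinguishability for the group `B`. -/
def TypeRel (k n B t t' : ℕ) : Prop :=
  (∀ a < k, B.testBit a = true → TypeBit 0 t 0 a ∧ TypeBit 0 t' 0 a ∧
    ∀ p < n + 1, TypeBit 1 t p a ↔ TypeBit 1 t' p a) ∧
  (∀ C < 2 ^ k, (∀ a < k, C.testBit a = true → B.testBit a = true) →
    ∀ r < n + 1, TypeBit 2 t r C ↔ TypeBit 2 t' r C) ∧
  ((∀ a < k, TypeBit 0 t 0 a → B.testBit a = true) ↔
    ∀ a < k, TypeBit 0 t' 0 a → B.testBit a = true)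

/-- The closure conditions on a single type, for the formulas whose codes are in `Fc`;
`idx` maps codes of agents to their numbers. -/
def TypeLocal (Fc : ℕ → Prop) (idx : ℕ → ℕ) (k n t : ℕ) : Prop :=
  (∃ a < k, TypeBit 0 t 0 a) ∧
  (∀ p < n + 1, ∀ a < k, TypeBit 1 t p a → TypeBit 0 t 0 a) ∧
  ∀ s < k ^ (n + 1),
    (∀ p < n + 1, ∀ x < n + 1, Nat.pair 0 (Nat.pair p x) < n + 1 → Fc (Nat.pair 0 (Nat.pair p x)) →
      (TypeBit 3 t (Nat.pair 0 (Nat.pair p x)) s ↔ TypeBit 1 t p (digit k s x))) ∧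
    (Nat.pair 1 0 < n + 1 → TypeBit 3 t (Nat.pair 1 0) s) ∧
    (∀ r < n + 1, Nat.pair 2 r < n + 1 → Fc (Nat.pair 2 r) →
      (TypeBit 3 t (Nat.pair 2 r) s ↔ ¬ TypeBit 3 t r s)) ∧
    (∀ r < n + 1, ∀ r' < n + 1, Nat.pair 3 (Nat.pair r r') < n + 1 →
      Fc (Nat.pair 3 (Nat.pair r r')) →
      (TypeBit 3 t (Nat.pair 3 (Nat.pair r r')) s ↔ (TypeBit 3 t r s ∧ TypeBit 3 t r' s))) ∧
    (∀ x < n + 1, ∀ a < n + 1, ∀ r < n + 1, Nat.pair 4 (Nat.pair (Nat.pair x a) r) < n + 1 →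
      Fc (Nat.pair 4 (Nat.pair (Nat.pair x a) r)) →
      -- The updated assignment is characterized by its digits instead of being computed.
      ∀ s' < k ^ (n + 1), (∀ y < n + 1, ¬ y = x → digit k s' y = digit k s y) →
        digit k s' x = idx a →
        (TypeBit 3 t (Nat.pair 4 (Nat.pair (Nat.pair x a) r)) s ↔
          (TypeBit 0 t 0 (idx a) → TypeBit 3 t r s'))) ∧
    (∀ S < n + 1, ∀ r < n + 1, Nat.pair 5 (Nat.pair S r) < n + 1 → Fc (Nat.pair 5 (Nat.pair S r)) →
      ∀ B < 2 ^ k,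
        (∀ a < k, B.testBit a = true ↔ ∃ x < n + 1, S.testBit x = true ∧ digit k s x = a) →
        (TypeBit 3 t (Nat.pair 5 (Nat.pair S r)) s ↔ TypeBit 2 t r B))

/-- The condition on the knowledge entries of a type `t` in the set `T` of types. -/
def TypeKnow (Sc : ℕ → Prop) (k n T t : ℕ) : Prop :=
  ∀ B < 2 ^ k, ∀ r < n + 1, Sc r →
    (TypeBit 2 t r B ↔ ∀ t' < 2 ^ typeBound k n, T.testBit t' = true → TypeRel k n B t t' →
      ∀ s < k ^ (n + 1), TypeBit 3 t' r s)

/-- Some coherent set of types contains a type that satisfies the formula with code `n`. -/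
def HasTypeModel (Fc Sc : ℕ → Prop) (idx : ℕ → ℕ) (k n : ℕ) : Prop :=
  ∃ T < 2 ^ 2 ^ typeBound k n,
    (∃ t < 2 ^ typeBound k n, T.testBit t = true ∧ ∃ s < k ^ (n + 1), TypeBit 3 t n s) ∧
    ∀ t < 2 ^ typeBound k n, T.testBit t = true → TypeLocal Fc idx k n t ∧ TypeKnow Sc k n T t

section Primrec

variable {E : Type*} [Primcodable E]

theorem primrecPred_typeBit (c : ℕ) {t m s : E → ℕ} (ht : Primrec t) (hm : Primrec m)
    (hs : Primrec s) : PrimrecPred fun e => TypeBit c (t e) (m e) (s e) :=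
  primrecPred_testBit ht (by fun_prop)

theorem primrec_digit {k s x : E → ℕ} (hk : Primrec k) (hs : Primrec s) (hx : Primrec x) :
    Primrec fun e => digit (k e) (s e) (x e) := by
  unfold digit
  fun_prop

theorem primrec_typeBound {k n : E → ℕ} (hk : Primrec k) (hn : Primrec n) :
    Primrec fun e => typeBound (k e) (n e) := by
  unfold typeBound
  fun_prop

attribute [fun_prop] primrec_digit primrec_typeBound

theorem primrecPred_typeRel {k n B t t' : E → ℕ} (hk : Primrec k) (hn : Primrec n)
    (hB : Primrec B) (ht : Primrec t) (ht' : Primrec t') :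
    PrimrecPred fun e => TypeRel (k e) (n e) (B e) (t e) (t' e) := by
  unfold TypeRel TypeBit
  repeat' first
    | refine primrecPred_forall_lt (by fun_prop) ?_
    | refine PrimrecPred.and ?_ ?_
    | refine primrecPred_testBit (by fun_prop) (by fun_prop)
    | refine primrecPred_iff ?_ ?_
    | refine primrecPred_imp ?_ ?_

variable {Fc Sc : ℕ → Prop} {idx : ℕ → ℕ}

theorem primrecPred_typeLocal (hF : PrimrecPred Fc) (hidx : Primrec idx) {k n t : E → ℕ}
    (hk : Primrec k) (hn : Primrec n) (ht : Primrec t) :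
    PrimrecPred fun e => TypeLocal Fc idx (k e) (n e) (t e) := by
  have hF' : ∀ {E' : Type _} [Primcodable E'] {f : E' → ℕ}, Primrec f →
      PrimrecPred fun e => Fc (f e) := fun hf => hF.comp hf
  unfold TypeLocal TypeBit
  repeat' first
    | refine primrecPred_forall_lt (by fun_prop) ?_
    | refine primrecPred_exists_lt (by fun_prop) ?_
    | refine PrimrecPred.and ?_ ?_
    | refine PrimrecPred.not ?_
    | refine primrecPred_testBit (by fun_prop) (by fun_prop)
    | refine primrecPred_eq (by fun_prop) (by fun_prop)
    | refine primrecPred_lt (by fun_prop) (by fun_prop)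
    | refine hF' (by fun_prop)
    | refine primrecPred_iff ?_ ?_
    | refine primrecPred_imp ?_ ?_

theorem primrecPred_typeKnow (hS : PrimrecPred Sc) {k n T t : E → ℕ}
    (hk : Primrec k) (hn : Primrec n) (hT : Primrec T) (ht : Primrec t) :
    PrimrecPred fun e => TypeKnow Sc (k e) (n e) (T e) (t e) := by
  have hS' : ∀ {E' : Type _} [Primcodable E'] {f : E' → ℕ}, Primrec f →
      PrimrecPred fun e => Sc (f e) := fun hf => hS.comp hf
  unfold TypeKnow TypeBit
  repeat' first
    | refine primrecPred_forall_lt (by fun_prop) ?_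
    | refine primrecPred_testBit (by fun_prop) (by fun_prop)
    | refine primrecPred_typeRel (by fun_prop) (by fun_prop) (by fun_prop) (by fun_prop) (by fun_prop)
    | refine hS' (by fun_prop)
    | refine primrecPred_iff ?_ ?_
    | refine primrecPred_imp ?_ ?_

theorem primrecPred_hasTypeModel (hF : PrimrecPred Fc) (hS : PrimrecPred Sc)
    (hidx : Primrec idx) (k : ℕ) : PrimrecPred (HasTypeModel Fc Sc idx k) := by
  unfold HasTypeModel
  refine primrecPred_exists_lt (by fun_prop) (.and ?_ ?_)
  · exact primrecPred_exists_lt (by fun_prop) <|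
      (primrecPred_testBit (by fun_prop) (by fun_prop)).and <|
        primrecPred_exists_lt (by fun_prop) <|
          primrecPred_typeBit _ (by fun_prop) (by fun_prop) (by fun_prop)
  · exact primrecPred_forall_lt (by fun_prop) <|
      primrecPred_imp (primrecPred_testBit (by fun_prop) (by fun_prop)) <|
        (primrecPred_typeLocal hF hidx (by fun_prop) (by fun_prop) (by fun_prop)).and <|
          primrecPred_typeKnow hS (by fun_prop) (by fun_prop) (by fun_prop) (by fun_prop)

end Primrec

/-! ### Correctness of coded types -/

namespace TypeRel

variable {k n B C t t' t'' : ℕ}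

theorem refl (h : ∀ a < k, B.testBit a = true → TypeBit 0 t 0 a) : TypeRel k n B t t :=
  ⟨fun a ha hB => ⟨h a ha hB, h a ha hB, fun _ _ => Iff.rfl⟩, fun _ _ _ _ _ => Iff.rfl, Iff.rfl⟩

theorem symm (h : TypeRel k n B t t') : TypeRel k n B t' t :=
  ⟨fun a ha hB => ⟨(h.1 a ha hB).2.1, (h.1 a ha hB).1, fun p hp => ((h.1 a ha hB).2.2 p hp).symm⟩,
    fun C hC hCB r hr => (h.2.1 C hC hCB r hr).symm, h.2.2.symm⟩

theorem trans (h : TypeRel k n B t t') (h' : TypeRel k n B t' t'') : TypeRel k n B t t'' :=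
  ⟨fun a ha hB => ⟨(h.1 a ha hB).1, (h'.1 a ha hB).2.1,
      fun p hp => ((h.1 a ha hB).2.2 p hp).trans ((h'.1 a ha hB).2.2 p hp)⟩,
    fun C hC hCB r hr => (h.2.1 C hC hCB r hr).trans (h'.2.1 C hC hCB r hr), h.2.2.trans h'.2.2⟩

/-- Only the clause on domains is delicate. If `B` includes the domain of `u`, so does `C`, hence
`C` includes the domain of `u'`. Its agents then lie in `C`, so they are alive at `u` and thus
belong to `B`. -/
theorem mono (hBC : ∀ a < k, B.testBit a = true → C.testBit a = true) (h : TypeRel k n C t t') :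
    TypeRel k n B t t' := by
  have key : ∀ {u u'}, TypeRel k n C u u' → (∀ a < k, TypeBit 0 u 0 a → B.testBit a = true) →
      ∀ a < k, TypeBit 0 u' 0 a → B.testBit a = true := fun hr hu a ha ha' =>
    hu a ha (hr.1 a ha (hr.2.2.1 (fun b hb hb' => hBC b hb (hu b hb hb')) a ha ha')).1
  exact ⟨fun a ha hB => h.1 a ha (hBC a ha hB),
    fun D hD hDB r hr => h.2.1 D hD (fun a ha ha' => hBC a ha (hDB a ha ha')) r hr,
    key h, key h.symm⟩

end TypeRel

section Agents

variable {A : Type uA} {X : Type uX} {k : ℕ} (e : A ≃ Fin k)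

theorem forall_lt_iff_forall {p : ℕ → Prop} : (∀ i < k, p i) ↔ ∀ a, p (e a) :=
  ⟨fun h a => h _ (e a).2, fun h i hi => by simpa using h (e.symm ⟨i, hi⟩)⟩

theorem exists_groupCode (B : Set A) :
    ∃ m < 2 ^ k, ∀ a, m.testBit (e a) = true ↔ a ∈ B := by
  obtain ⟨m, hm, h⟩ := exists_lt_two_pow_testBit k fun i => ∃ a ∈ B, (e a : ℕ) = i
  refine ⟨m, hm, fun a => (h _ (e a).2).trans ⟨?_, fun ha => ⟨a, ha, rfl⟩⟩⟩
  rintro ⟨b, hb, hab⟩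
  rwa [← e.injective (Fin.ext hab)]

/-- The number whose bits equal to one are the numbers of the agents in `B`. -/
noncomputable def groupCode (B : Set A) : ℕ := (exists_groupCode e B).choose

theorem groupCode_lt (B : Set A) : groupCode e B < 2 ^ k := (exists_groupCode e B).choose_spec.1

theorem testBit_groupCode (B : Set A) (a : A) :
    (groupCode e B).testBit (e a) = true ↔ a ∈ B := (exists_groupCode e B).choose_spec.2 a

/-- The assignment coded by the digits of `s`. -/
def assignmentOf [NeZero k] [Encodable X] (s : ℕ) (x : X) : A :=
  e.symm ⟨digit k s (Encodable.encode x), Nat.mod_lt _ (NeZero.pos k)⟩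

theorem coe_assignmentOf [NeZero k] [Encodable X] (s : ℕ) (x : X) :
    (e (assignmentOf e s x) : ℕ) = digit k s (Encodable.encode x) := by
  simp [assignmentOf]

theorem assignmentOf_eq [NeZero k] [Encodable X] {s : ℕ} {x : X} {a : A}
    (h : digit k s (Encodable.encode x) = e a) : assignmentOf e s x = a :=
  e.injective (Fin.ext ((coe_assignmentOf e s x).trans h))

theorem exists_assignmentOf_eq [NeZero k] [Encodable X] (N : ℕ) (σ : X → A) :
    ∃ s < k ^ N, ∀ x : X, Encodable.encode x < N → assignmentOf e s x = σ x := by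
  obtain ⟨s, hs, h⟩ := exists_lt_pow_digit (k := k) N
    (fun i => ((Encodable.decode i : Option X).elim 0 fun x => (e (σ x) : ℕ))) fun i => by
      cases (Encodable.decode i : Option X) with
      | none => exact NeZero.pos k
      | some x => exact (e (σ x)).2
  exact ⟨s, hs, fun x hx => assignmentOf_eq e (by rw [h _ hx]; simp)⟩

/-- The number of the agent with a given code. -/
def agentIndex [Encodable A] (m : ℕ) : ℕ :=
  -- The default `0` is harmless: assignment conditions concern only codes of formulas, where `m` is
  -- the code of an agent.
  (Encodable.decode m : Option A).elim 0 fun a => (e a : ℕ)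

theorem agentIndex_encode [Encodable A] (a : A) : agentIndex e (Encodable.encode a) = e a := by
  simp [agentIndex]

/-- Every function on a finite type is primitive recursive, so the arbitrary choice of `e` does not
matter. -/
theorem primrec_agentIndex [Finite A] [Primcodable A] : Primrec (agentIndex e) := by
  have h : Primrec₂ fun (_ : ℕ) (a : A) => (e a : ℕ) :=
    (Primrec.dom_finite fun a : A => (e a : ℕ)).comp Primrec.snd
  refine (Primrec.option_casesOn Primrec.decode (Primrec.const 0) h).of_eq fun m => ?_
  unfold agentIndex
  cases (Encodable.decode m : Option A) <;> rfl

end Agents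

section TypeBound

variable {k n m s : ℕ}

theorem pair_lt_two_pow_typeBound {c : ℕ} (hc : c ≤ 3) (hm : m ≤ n)
    (hs : s ≤ k + 2 ^ k + k ^ (n + 1)) : Nat.pair c (Nat.pair m s) < typeBound k n :=
  Nat.lt_succ_of_le (pair_le_pair hc (pair_le_pair hm hs))

end TypeBound

/-! ### Types realized in a quasi-model. -/

section Soundness

variable {A : Type uA} {P : Type uP} {X : Type uX} [DecidableEq X]
  [Encodable P] [Encodable A] [Encodable X] {k : ℕ} [NeZero k]

/-- The number `t` codes the type of the world `u`. -/
structure IsTypeOf (X : Type uX) [DecidableEq X] [Encodable X] (e : A ≃ Fin k)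
    (M : QuasiModel.{uA, uP, w} A P) (n : ℕ) (u : M.W) (t : ℕ) : Prop where
  dom_iff : ∀ a, TypeBit 0 t 0 (e a) ↔ a ∈ M.dom u
  interp_iff : ∀ m ≤ n, ∀ a,
    TypeBit 1 t m (e a) ↔ ∃ p : P, Encodable.encode p = m ∧ a ∈ M.interp p u
  know_iff : ∀ m ≤ n, ∀ B < 2 ^ k, TypeBit 2 t m B ↔ ∃ α : Form A P X, α.code = m ∧
    ∀ v, M.R {a | B.testBit (e a) = true} u v → ∀ σ : X → A, M.Sat v σ α
  sat_iff : ∀ φ : Form A P X, φ.code ≤ n → ∀ s < k ^ (n + 1),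
    TypeBit 3 t φ.code s ↔ M.Sat u (assignmentOf e s) φ

theorem exists_isTypeOf (e : A ≃ Fin k) (M : QuasiModel.{uA, uP, w} A P) (n : ℕ) (u : M.W) :
    ∃ t < 2 ^ typeBound k n, IsTypeOf X e M n u t := by
  obtain ⟨t, ht, h⟩ := exists_lt_two_pow_testBit (typeBound k n) fun i =>
    (∃ a, Nat.pair 0 (Nat.pair 0 (e a)) = i ∧ a ∈ M.dom u) ∨
    (∃ (p : P) (a : A), Nat.pair 1 (Nat.pair (Encodable.encode p) (e a)) = i ∧ a ∈ M.interp p u) ∨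
    (∃ (α : Form A P X) (B : ℕ), Nat.pair 2 (Nat.pair α.code B) = i ∧
      ∀ v, M.R {a | B.testBit (e a) = true} u v → ∀ σ : X → A, M.Sat v σ α) ∨
    (∃ (φ : Form A P X) (s : ℕ), Nat.pair 3 (Nat.pair φ.code s) = i ∧
      M.Sat u (assignmentOf e s) φ)
  have hlt : ∀ a, (e a : ℕ) ≤ k + 2 ^ k + k ^ (n + 1) := fun a =>
    (e a).2.le.trans ((Nat.le_add_right _ _).trans (Nat.le_add_right _ _))
  refine ⟨t, ht, ⟨fun a => ?_, fun m hm a => ?_, fun m hm B hB => ?_, fun φ hφ s hs => ?_⟩⟩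
  · refine (h _ (pair_lt_two_pow_typeBound (by omega) (by omega) (hlt a))).trans ?_
    simp [Nat.pair_eq_pair, Fin.val_inj]
  · refine (h _ (pair_lt_two_pow_typeBound (by omega) hm (hlt a))).trans ?_
    simp [Nat.pair_eq_pair, Fin.val_inj]
  · refine (h _ (pair_lt_two_pow_typeBound (by omega) hm (hB.le.trans ((Nat.le_add_left _ _).trans
      (Nat.le_add_right _ _))))).trans ?_
    simp [Nat.pair_eq_pair, and_assoc]
  · refine (h _ (pair_lt_two_pow_typeBound (by omega) hφ (hs.le.trans (Nat.le_add_left _ _)))).trans ?_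
    simp [Nat.pair_eq_pair, Form.code_injective.eq_iff]

namespace IsTypeOf

variable {e : A ≃ Fin k} {M : QuasiModel.{uA, uP, w} A P} {n : ℕ} {u v : M.W} {t t' : ℕ}

/-- The filtration only coarsens the group relations. For `C ⊆ B`, related worlds lie in the same
class of `R C`, so `C` has the same knowledge at both. -/
theorem typeRel (h : IsTypeOf X e M n u t) (h' : IsTypeOf X e M n v t') {B : ℕ}
    (hR : M.R {a | B.testBit (e a) = true} u v) : TypeRel k n B t t' := by
  refine ⟨(forall_lt_iff_forall e).2 fun a ha => ⟨(h.dom_iff a).2 (M.subset_dom hR ha),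
    (h'.dom_iff a).2 (M.subset_dom (M.symm hR) ha), fun p hp => ?_⟩, fun C hC hCB r hr => ?_, ?_⟩
  · rw [h.interp_iff p (by omega), h'.interp_iff p (by omega)]
    exact exists_congr fun p => and_congr_right fun _ =>
      ⟨M.local_predicates hR ha, M.local_predicates (M.symm hR) ha⟩
  · rw [h.know_iff r (by omega) C hC, h'.know_iff r (by omega) C hC]
    have hRC := M.mono (fun a ha => (forall_lt_iff_forall e).1 hCB a ha) hR
    exact exists_congr fun α => and_congr_right fun _ => forall_congr' fun z => imp_congr
      ⟨M.trans (M.symm hRC), M.trans hRC⟩ Iff.rfl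
  · rw [forall_lt_iff_forall e, forall_lt_iff_forall e]
    simp only [h.dom_iff, h'.dom_iff]
    exact ⟨M.decreasing hR, M.decreasing (M.symm hR)⟩

theorem typeLocal (h : IsTypeOf X e M n u t) :
    TypeLocal (IsFormulaCode A P X) (agentIndex e) k n t := by
  have hle : ∀ {c i}, i ≤ Nat.pair c i := fun {c i} => Nat.right_le_pair c i
  refine ⟨?_, fun p hp => (forall_lt_iff_forall e).2 fun a ha => ?_, fun s hs =>
    ⟨fun p hp x hx hlt hF => ?_, fun hlt => ?_, fun r hr hlt hF => ?_, fun r hr r' hr' hlt hF => ?_,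
      fun x hx a ha r hr hlt hF s' hs' hd hx' => ?_, fun S hS r hr hlt hF B hB hBS => ?_⟩⟩
  · obtain ⟨a, ha⟩ := M.dom_nonempty u
    exact ⟨e a, (e a).2, (h.dom_iff a).2 ha⟩
  · obtain ⟨p, -, hp⟩ := (h.interp_iff p (by omega) a).1 ha
    exact (h.dom_iff a).2 (M.interp_subset p u hp)
  · obtain ⟨φ, hφ, hc⟩ := hF
    cases φ <;> simp only [Form.code, Nat.pair_eq_pair] at hc <;> try omega
    obtain ⟨-, rfl, rfl⟩ := hc
    rename_i p x
    rw [← coe_assignmentOf e, h.interp_iff _ (by omega)]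
    refine (h.sat_iff (.atom p x) (Nat.le_of_lt_succ hlt) s hs).trans ?_
    simp [QuasiModel.Sat]
  · exact (h.sat_iff .top (Nat.le_of_lt_succ hlt) s hs).2 trivial
  · obtain ⟨φ, hφ, hc⟩ := hF
    cases φ <;> simp only [Form.code, Nat.pair_eq_pair] at hc <;> try omega
    obtain ⟨-, rfl⟩ := hc
    rename_i φ
    rw [h.sat_iff φ (by omega) s hs]
    exact h.sat_iff (.neg φ) (Nat.le_of_lt_succ hlt) s hs
  · obtain ⟨φ, hφ, hc⟩ := hF
    cases φ <;> simp only [Form.code, Nat.pair_eq_pair] at hc <;> try omega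
    obtain ⟨-, rfl, rfl⟩ := hc
    rename_i φ ψ
    rw [h.sat_iff φ (by omega) s hs, h.sat_iff ψ (by omega) s hs]
    exact h.sat_iff (.and φ ψ) (Nat.le_of_lt_succ hlt) s hs
  · obtain ⟨φ, hφ, hc⟩ := hF
    cases φ <;> simp only [Form.code, Nat.pair_eq_pair] at hc <;> try omega
    obtain ⟨-, ⟨rfl, rfl⟩, rfl⟩ := hc
    rename_i x a φ
    rw [agentIndex_encode] at hx' ⊢
    rw [h.sat_iff φ (by omega) s' hs', h.dom_iff]
    refine (h.sat_iff (.assign x a φ) (Nat.le_of_lt_succ hlt) s hs).trans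
      (imp_congr_right fun _ => M.sat_congr φ hφ u _ _ fun y hy => ?_)
    have hy' := Form.encode_le_code_of_mem_FV hy
    by_cases hyx : y = x
    · subst hyx
      rw [Function.update_self, assignmentOf_eq e hx']
    · rw [Function.update_of_ne hyx]
      refine (assignmentOf_eq e ?_).symm
      rw [coe_assignmentOf, hd _ (by omega) fun hxy => hyx (Encodable.encode_injective hxy)]
  · obtain ⟨φ, hφ, hc⟩ := hF
    cases φ <;> simp only [Form.code, Nat.pair_eq_pair] at hc <;> try omega
    obtain ⟨-, rfl, rfl⟩ := hc
    rename_i S α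
    rw [h.know_iff _ (by omega) B hB]
    refine (h.sat_iff (.know S α) (Nat.le_of_lt_succ hlt) s hs).trans ?_
    have hset : assignmentOf e s '' (S : Set X) = {a | B.testBit (e a) = true} := by
      ext a
      rw [Set.mem_ofPred_eq, hBS _ (e a).2]
      constructor
      · rintro ⟨x, hx, rfl⟩
        have hb := (testBit_sum_two_pow_encode S _).2 ⟨x, hx, rfl⟩
        exact ⟨Encodable.encode x, (lt_of_testBit hb).trans hS, hb, (coe_assignmentOf e s x).symm⟩
      · rintro ⟨i, -, hb, ha⟩
        obtain ⟨x, hx, rfl⟩ := (testBit_sum_two_pow_encode S _).1 hb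
        exact ⟨x, hx, assignmentOf_eq e ha⟩
    simp only [QuasiModel.Sat, hset]
    constructor
    · exact fun hv => ⟨α, rfl, fun v hR σ =>
        (M.sat_congr α hφ.1 v _ _ (by simp [hφ.2])).1 (hv v hR)⟩
    · rintro ⟨β, hβ, hv⟩ v hR
      obtain rfl := Form.code_injective hβ
      exact hv v hR _

end IsTypeOf

variable {e : A ≃ Fin k}

/-- The coherent set consists of the types of all worlds. -/
theorem QuasiModel.Satisfiable.hasTypeModel {α : Form A P X} (hα : α.IsFormula)
    (h : QuasiModel.Satisfiable.{uA, uP, uX, w} α) :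
    HasTypeModel (IsFormulaCode A P X) (IsSentenceCode A P X) (agentIndex e) k α.code := by
  obtain ⟨M, u, σ, hu⟩ := h
  choose ty hty hM using exists_isTypeOf (X := X) e M α.code
  obtain ⟨T, hT, hTb⟩ := exists_lt_two_pow_testBit (2 ^ typeBound k α.code) fun t => ∃ v, ty v = t
  refine ⟨T, hT, ⟨ty u, hty u, (hTb _ (hty u)).2 ⟨u, rfl⟩, ?_⟩, fun t ht htT => ?_⟩
  · obtain ⟨s, hs, hsσ⟩ := exists_assignmentOf_eq e (α.code + 1) σ
    refine ⟨s, hs, ((hM u).sat_iff α le_rfl s hs).2 ((M.sat_congr α hα u _ _ fun x hx => ?_).2 hu)⟩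
    exact hsσ x (Nat.lt_succ_of_le (Form.encode_le_code_of_mem_FV hx))
  · obtain ⟨u, rfl⟩ := (hTb _ ht).1 htT
    refine ⟨(hM u).typeLocal, fun B hB r hr hS => ?_⟩
    obtain ⟨β, hβ, rfl⟩ := hS
    constructor
    · intro hk t' ht' htT' hR s hs
      obtain ⟨v, rfl⟩ := (hTb _ ht').1 htT'
      -- Related types agree on the knowledge of `B`, so `B` also knows the sentence at `v`;
      -- reflexivity of `R B` then makes it true there, although `u` and `v` need not be related in
      -- `M`.
      rw [hR.2.1 B hB (fun _ _ h => h) _ hr, (hM v).know_iff _ (by omega) B hB] at hk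
      obtain ⟨γ, hγ, hv⟩ := hk
      obtain rfl := Form.code_injective hγ
      refine ((hM v).sat_iff γ (by omega) s hs).2 (hv v (M.refl fun a ha => ?_) _)
      exact ((hM v).dom_iff a).1 (hR.1 _ (e a).2 ha).2.1
    · intro hk
      refine ((hM u).know_iff _ (by omega) B hB).2 ⟨β, rfl, fun v hR σ => ?_⟩
      -- A sentence does not depend on the assignment, so it is evaluated at the one coded by `0`.
      have h0 : 0 < k ^ (α.code + 1) := pow_pos (NeZero.pos k) _
      have := hk _ (hty v) ((hTb _ (hty v)).2 ⟨v, rfl⟩) ((hM u).typeRel (hM v) hR) 0 h0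
      rw [(hM v).sat_iff β (by omega) 0 h0] at this
      exact (M.sat_congr β hβ.1 v _ _ (by simp [hβ.2])).1 this

end Soundness

/-! ### The quasi-model of a coherent set of types. -/

section Completeness

variable {A : Type uA} {P : Type uP} {X : Type uX} [DecidableEq X]
  [Encodable P] [Encodable A] [Encodable X] {k : ℕ} {e : A ≃ Fin k} {n T : ℕ}
  {Fc : ℕ → Prop} {idx : ℕ → ℕ}

variable (P e) in
/-- The quasi-model whose worlds are the types in `T`. -/
noncomputable def typeModel
    (hT : ∀ t < 2 ^ typeBound k n, T.testBit t = true → TypeLocal Fc idx k n t) :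
    QuasiModel.{uA, uP, w} A P where
  W := ULift.{w} {t : ℕ // t < 2 ^ typeBound k n ∧ T.testBit t = true}
  dom u := {a | TypeBit 0 u.down.1 0 (e a)}
  dom_nonempty u := by
    obtain ⟨i, hi, h⟩ := (hT _ u.down.2.1 u.down.2.2).1
    exact ⟨e.symm ⟨i, hi⟩, by simpa using h⟩
  R B u v := TypeRel k n (groupCode e B) u.down.1 v.down.1
  -- Related types need agree only on predicate letters with code at most `n`; the others are made
  -- empty to keep predicates local.
  interp p u := {a | Encodable.encode p < n + 1 ∧ TypeBit 1 u.down.1 (Encodable.encode p) (e a)}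
  interp_subset p u a ha := (hT _ u.down.2.1 u.down.2.2).2.1 _ ha.1 _ (e a).2 ha.2
  subset_dom h a ha := (h.1 _ (e a).2 ((testBit_groupCode e _ a).2 ha)).1
  refl h := TypeRel.refl <| (forall_lt_iff_forall e).2 fun a ha =>
    h ((testBit_groupCode e _ a).1 ha)
  symm h := h.symm
  trans h h' := h.trans h'
  mono hBC h := h.mono <| (forall_lt_iff_forall e).2 fun a ha =>
    (testBit_groupCode e _ a).2 (hBC ((testBit_groupCode e _ a).1 ha))
  local_predicates {_ _ _ _ a} h ha hp :=
    ⟨hp.1, ((h.1 _ (e a).2 ((testBit_groupCode e _ a).2 ha)).2.2 _ hp.1).1 hp.2⟩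
  decreasing h hB a ha := (testBit_groupCode e _ a).1 <| h.2.2.1
    ((forall_lt_iff_forall e).2 fun b hb => (testBit_groupCode e _ b).2 (hB hb)) _ (e a).2 ha

/-- This is the truth lemma. The numeral `s` need only represent `σ` on variables with code at most
`n`, which include all free variables of `φ`. -/
theorem sat_typeModel [NeZero k]
    (hT : ∀ t < 2 ^ typeBound k n, T.testBit t = true →
      TypeLocal (IsFormulaCode A P X) (agentIndex e) k n t)
    (hK : ∀ t < 2 ^ typeBound k n, T.testBit t = true →
      TypeKnow (IsSentenceCode A P X) k n T t) (φ : Form A P X) :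
    φ.IsFormula → φ.code ≤ n → ∀ (u : (typeModel.{uA, uP, w} P e hT).W) (σ : X → A),
      ∀ s < k ^ (n + 1), (∀ x, Encodable.encode x < n + 1 → assignmentOf e s x = σ x) →
      ((typeModel.{uA, uP, w} P e hT).Sat u σ φ ↔ TypeBit 3 u.down.1 φ.code s) := by
  have hle : ∀ {c i}, i ≤ Nat.pair c i := fun {c i} => Nat.right_le_pair c i
  have hle' : ∀ {c i}, c ≤ Nat.pair c i := fun {c i} => Nat.left_le_pair c i
  induction φ with
  | atom p x =>
    intro hφ hn u σ s hs hσ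
    have hp : Encodable.encode p < n + 1 :=
      Nat.lt_succ_of_le ((hle'.trans (hle (c := 0) (i := Nat.pair _ (Encodable.encode x)))).trans hn)
    have hx : Encodable.encode x < n + 1 :=
      Nat.lt_succ_of_le ((hle.trans (hle (c := 0) (i := Nat.pair (Encodable.encode p) _))).trans hn)
    have h := ((hT _ u.down.2.1 u.down.2.2).2.2 s hs).1 _ hp _ hx (Nat.lt_succ_of_le hn)
      ⟨.atom p x, hφ, rfl⟩
    rw [← coe_assignmentOf e, hσ x hx] at h
    exact (and_iff_right hp).trans h.symm
  | top =>
    intro hφ hn u σ s hs hσ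
    exact iff_of_true trivial
      (((hT _ u.down.2.1 u.down.2.2).2.2 s hs).2.1 (Nat.lt_succ_of_le hn))
  | neg φ ih =>
    intro hφ hn u σ s hs hσ
    have hr : φ.code ≤ n := hle.trans hn
    have h := ((hT _ u.down.2.1 u.down.2.2).2.2 s hs).2.2.1 _ (Nat.lt_succ_of_le hr)
      (Nat.lt_succ_of_le hn) ⟨.neg φ, hφ, rfl⟩
    exact (not_congr (ih hφ hr u σ s hs hσ)).trans h.symm
  | and φ ψ ih₁ ih₂ =>
    intro hφ hn u σ s hs hσ
    have hr : φ.code ≤ n := (hle'.trans hle).trans hn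
    have hr' : ψ.code ≤ n := (hle.trans hle).trans hn
    have h := ((hT _ u.down.2.1 u.down.2.2).2.2 s hs).2.2.2.1 _ (Nat.lt_succ_of_le hr) _
      (Nat.lt_succ_of_le hr') (Nat.lt_succ_of_le hn) ⟨.and φ ψ, hφ, rfl⟩
    exact (and_congr (ih₁ hφ.1 hr u σ s hs hσ) (ih₂ hφ.2 hr' u σ s hs hσ)).trans h.symm
  | assign x a φ ih =>
    intro hφ hn u σ s hs hσ
    have hx : Encodable.encode x ≤ n := ((hle'.trans hle').trans hle).trans hn
    have ha : Encodable.encode a ≤ n := ((hle.trans hle').trans hle).trans hn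
    have hr : φ.code ≤ n := (hle.trans hle).trans hn
    -- The numeral of the updated assignment, to which the local condition is applied.
    obtain ⟨s', hs', hd⟩ := exists_lt_pow_digit (k := k) (n + 1)
      (fun i => if i = Encodable.encode x then e a else digit k s i) fun i => by
        split_ifs
        · exact (e a).2
        · exact Nat.mod_lt _ (NeZero.pos k)
    have hdx : digit k s' (Encodable.encode x) = e a := by simp [hd _ (Nat.lt_succ_of_le hx)]
    have h := ((hT _ u.down.2.1 u.down.2.2).2.2 s hs).2.2.2.2.1 _ (Nat.lt_succ_of_le hx) _
      (Nat.lt_succ_of_le ha) _ (Nat.lt_succ_of_le hr) (Nat.lt_succ_of_le hn)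
      ⟨.assign x a φ, hφ, rfl⟩ s' hs' (fun y hy hne => by simp [hd y hy, hne])
      (by rw [hdx, agentIndex_encode])
    rw [agentIndex_encode] at h
    refine (imp_congr_right fun _ => ih hφ hr u _ s' hs' fun y hy => ?_).trans h.symm
    by_cases hyx : y = x
    · subst hyx
      rw [Function.update_self, assignmentOf_eq e hdx]
    · rw [Function.update_of_ne hyx, ← hσ y hy]
      refine assignmentOf_eq e ?_
      rw [hd _ hy, if_neg fun h => hyx (Encodable.encode_injective h), coe_assignmentOf]
  | know S α ih =>
    intro hφ hn u σ s hs hσ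
    have hS : ∑ x ∈ S, 2 ^ Encodable.encode x ≤ n := (hle'.trans hle).trans hn
    have hr : α.code ≤ n := (hle.trans hle).trans hn
    have h := ((hT _ u.down.2.1 u.down.2.2).2.2 s hs).2.2.2.2.2 _ (Nat.lt_succ_of_le hS) _
      (Nat.lt_succ_of_le hr) (Nat.lt_succ_of_le hn) ⟨.know S α, hφ, rfl⟩
      (groupCode e (σ '' (S : Set X))) (groupCode_lt e _) ((forall_lt_iff_forall e).2 fun a => ?_)
    · refine Iff.trans ?_ (h.trans (hK _ u.down.2.1 u.down.2.2 _ (groupCode_lt e _) _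
        (Nat.lt_succ_of_le hr) ⟨α, hφ, rfl⟩)).symm
      constructor
      · intro hv t ht htT hR s' hs'
        have hsat := hv ⟨⟨t, ht, htT⟩⟩ hR
        -- `TypeKnow` requires `α` under every coded assignment; since `α` is a sentence, its truth
        -- under `σ` suffices.
        exact (ih hφ.1 hr _ (assignmentOf e s') s' hs' fun _ _ => rfl).1
          ((QuasiModel.sat_congr _ α hφ.1 _ σ _ (by simp [hφ.2])).1 hsat)
      · intro hv v hR
        exact (ih hφ.1 hr v σ s hs hσ).2 (hv _ v.down.2.1 v.down.2.2 hR s hs)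
    · rw [testBit_groupCode]
      constructor
      · rintro ⟨x, hx, rfl⟩
        have hb := (testBit_sum_two_pow_encode S _).2 ⟨x, hx, rfl⟩
        have hxn := (lt_of_testBit hb).trans_le hS |>.trans_le n.le_succ
        exact ⟨Encodable.encode x, hxn, hb, by rw [← coe_assignmentOf e, hσ x hxn]⟩
      · rintro ⟨i, hi, hb, ha⟩
        obtain ⟨x, hx, rfl⟩ := (testBit_sum_two_pow_encode S _).1 hb
        exact ⟨x, hx, by rw [← hσ x hi, assignmentOf_eq e ha]⟩

theorem QuasiModel.satisfiable_of_hasTypeModel [NeZero k] {α : Form A P X} (hα : α.IsFormula)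
    (h : HasTypeModel (IsFormulaCode A P X) (IsSentenceCode A P X) (agentIndex e) k α.code) :
    QuasiModel.Satisfiable.{uA, uP, uX, w} α := by
  obtain ⟨T, -, ⟨t, ht, htT, s, hs, hts⟩, h⟩ := h
  have hT := fun t ht htT => (h t ht htT).1
  exact ⟨typeModel P e hT, ⟨⟨t, ht, htT⟩⟩, assignmentOf e s,
    (sat_typeModel hT (fun t ht htT => (h t ht htT).2) α hα le_rfl _ _ s hs fun _ _ => rfl).2 hts⟩

end Completeness

theorem computablePred_satisfiable (A : Type uA) (P : Type uP) (X : Type uX)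
    [Finite A] [Nonempty A] [Primcodable A] [Primcodable P] [Primcodable X] [DecidableEq X] :
    ComputablePred fun n : ℕ => ∃ α : Form A P X, α.IsSentence ∧ α.code = n ∧
      QuasiModel.Satisfiable.{uA, uP, uX, w} α := by
  obtain ⟨k, ⟨e⟩⟩ := Finite.exists_equiv_fin A
  have : NeZero k := ⟨by
    rintro rfl
    exact isEmptyElim (e (Classical.arbitrary A))⟩
  refine ((primrecPred_isSentenceCode A P X).and (primrecPred_hasTypeModel
    (primrecPred_isFormulaCode A P X) (primrecPred_isSentenceCode A P X)
    (primrec_agentIndex e) k)).computablePred.of_eq fun n => ?_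
  constructor
  · rintro ⟨⟨α, hα, rfl⟩, h⟩
    exact ⟨α, hα, rfl, QuasiModel.satisfiable_of_hasTypeModel hα.1 h⟩
  · rintro ⟨α, hα, rfl, h⟩
    exact ⟨⟨α, hα, rfl⟩, h.hasTypeModel hα.1⟩

end AssignLogic

theorem mainTheorem7 (A : Type uA) (P : Type uP) (X : Type uX)
    [Finite A] [Nonempty A] [Primcodable A] [Primcodable P] [Primcodable X] [DecidableEq X] :
    ComputablePred (fun n : ℕ => ∃ α : AssignLogic.Form A P X,
        α.IsSentence ∧ α.code = n ∧
          AssignLogic.Form.SimplicialSatisfiable.{uA, uP, uX, w} α) ∧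
      ComputablePred (fun n : ℕ => ∃ α : AssignLogic.Form A P X,
        α.IsSentence ∧ α.code = n ∧
          AssignLogic.Form.LocalEpistemicSatisfiable.{uA, uP, uX, w} α) := by
  simp only [AssignLogic.Form.simplicialSatisfiable_iff_localEpistemicSatisfiable,
    AssignLogic.Form.localEpistemicSatisfiable_iff_satisfiable, and_self]
  exact AssignLogic.computablePred_satisfiable A P X
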